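/- Let $M$ be a smooth $n$-dimensional manifold and let $(M,F)$ be a Finsler structure: $F:TM\to[0,\infty)$ is smooth on the slit tangent bundle $N=TM\setminus\{0\}$, satisfies $F(x,\lambda y)=\lambda F(x,y)$ for all $\lambda>0$, and, in all natural coordinates $(x^i,y^i)$, the matrix $g_{ij}(x,y)=\tfrac12\,\partial^2F^2/\partial y^i\partial y^j$ is positive definite for $y\neq 0$. Summing over repeated indices and writing $(g^{ij})=(g_{ij})^{-1}$, put $$\gamma^i_{jk}=\tfrac12 g^{is}\Big(\frac{\partial g_{sj}}{\partial x^k}-\frac{\partial g_{jk}}{\partial x^s}+\frac{\partial g_{sk}}{\partial x^j}\Big),\qquad G^i=\gamma^i_{jk}y^jy^k,\qquad A_{ijk}=\frac F2\frac{\partial g_{ij}}{\partial y^k},$$ $$N^i_j=\gamma^i_{jk}y^k-\frac1F\,g^{il}A_{ljk}\,\gamma^k_{rs}y^ry^s,\qquad \frac{\delta}{\delta x^k}=\frac{\partial}{\partial x^k}-N^m_k\frac{\partial}{\partial y^m}.$$ * The Chern connection is the linear connection on $\pi^*TM\to N$ with coefficients $\Gamma^i_{jk}=\tfrac12 g^{is}\big(\frac{\delta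 g_{sj}}{\delta x^k}-\frac{\delta g_{jk}}{\delta x^s}+\frac{\delta g_{sk}}{\delta x^j}\big)$, i.e. the unique solution of $\Gamma^i_{jk}=\Gamma^i_{kj}$ and $\frac{\delta g_{ij}}{\delta x^k}=g_{lj}\Gamma^l_{ik}+g_{il}\Gamma^l_{jk}$. The structure $(M,F)$ is *Berwald* if these coefficients live on $M$, i.e. in natural coordinates $\Gamma^i_{jk}(x,y)$ does not depend on $y\ne0$. * The linear Berwald connection is the linear connection on $\pi^*TM\to N$ with coefficients ${}^b\Gamma^i_{jk}=\tfrac12\,\partial^2G^i/\partial y^j\partial y^k$. * The geodesics of a connection with coefficients $\Gamma^i_{jk}(x,y)$, $y\neq0$, are the parametrized $C^2$ curves $x(t)$ in $M$, defined on open intervals and with nowhere vanishing velocity, which satisfy $\ddot x^i+\Gamma^i_{jk}(x,\dot x)\,\dot x^j\dot x^k=0$ in all local coordinates. The Levi-Civita connection of a Riemannian metric is regarded as such a connection, with coefficients independent of $y$. * A smooth Riemannian metric $h$ on $M$ is *affinely equivalent* to $(M,F)$ if the Levi-Civita connection of $h$ has the same parametrized geodesics as the linear Berwald connection of $(M,F)$.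 **Proposition 3.5.** There is a Riemannian metric $h$ on $M$ that is affinely equivalent to $(M,F)$ if and only if $(M,F)$ is Berwald. -/

import Mathlib

open Set Bundle
open scoped Manifold ContDiff

noncomputable section

namespace Finsler

/-- The coordinate space `ℝⁿ`. -/
abbrev Coord (n : ℕ) : Type := EuclideanSpace ℝ (Fin n)

/-- The partial derivative `∂f/∂xᵏ` of a real function on `ℝⁿ` at the point `x`. -/
def pd {n : ℕ} (k : Fin n) (f : Coord n → ℝ) (x : Coord n) : ℝ :=
  fderiv ℝ f x (EuclideanSpace.single k 1)

section Local

variable {n : ℕ} {M : Type*} [TopologicalSpace M] [ChartedSpace (Coord n) M]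

/-- The tangent vector `yⁱ ∂/∂xⁱ` at the point with coordinates `x` in the chart `e`, i.e. the
point of `TM` with natural coordinates `(x, y)`. -/
def natPoint (e : OpenPartialHomeomorph M (Coord n)) (x y : Coord n) : TangentBundle (𝓡 n) M :=
  ⟨e.symm x, mfderiv (𝓡 n) (𝓡 n) e.symm x y⟩

/-- The expression `F(x, y)` of a function on `TM` in the natural coordinates of the chart `e`. -/
def localRep (F : TangentBundle (𝓡 n) M → ℝ) (e : OpenPartialHomeomorph M (Coord n))
    (x y : Coord n) : ℝ :=
  F (natPoint e x y)

/-- The matrix `g_ij(x, y) = ½ ∂²F²/∂yⁱ∂yʲ`. -/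
def fundMatrix (F : TangentBundle (𝓡 n) M → ℝ) (e : OpenPartialHomeomorph M (Coord n))
    (x y : Coord n) : Matrix (Fin n) (Fin n) ℝ :=
  Matrix.of fun i j => 1 / 2 * pd i (fun y' => pd j (fun y'' => localRep F e x y'' ^ 2) y') y

end Local

/-- A Finsler structure on the smooth `n`-manifold `M`: a non-negative function on `TM`, smooth on
the slit tangent bundle, positively homogeneous of degree one on the fibres, whose matrices
`g_ij(x, y)`, `y ≠ 0`, are positive definite in all natural coordinate systems. -/
structure FinslerStructure (n : ℕ) (M : Type*) [TopologicalSpace M] [ChartedSpace (Coord n) M]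
    [IsManifold (𝓡 n) ∞ M] where
  /-- the Finsler function -/
  toFun : TangentBundle (𝓡 n) M → ℝ
  nonneg : ∀ v, 0 ≤ toFun v
  smooth : ContMDiffOn (𝓡 n).tangent 𝓘(ℝ, ℝ) ∞ toFun {v | v.2 ≠ 0}
  homog : ∀ (p : M) (v : TangentSpace (𝓡 n) p) (c : ℝ), 0 < c →
    toFun ⟨p, c • v⟩ = c * toFun ⟨p, v⟩
  posDef : ∀ e ∈ IsManifold.maximalAtlas (𝓡 n) ∞ M, ∀ x ∈ e.target, ∀ y : Coord n, y ≠ 0 →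
    (fundMatrix toFun e x y).PosDef

/-- A family of coefficients `Γⁱ_jk(x, y)`, one for each chart `e` of `M` (the arguments are, in
this order, `e x y i j k`). These are the data of a linear connection on `π*TM → N` with
connection forms `ωⁱ_j = Γⁱ_jk(x, y) dxᵏ`. -/
abbrev ConnCoeff (n : ℕ) (M : Type*) [TopologicalSpace M] : Type _ :=
  OpenPartialHomeomorph M (Coord n) → Coord n → Coord n → Fin n → Fin n → Fin n → ℝ

section Connections

variable {n : ℕ} {M : Type*} [TopologicalSpace M] [ChartedSpace (Coord n) M]
  [IsManifold (𝓡 n) ∞ M]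

namespace FinslerStructure

variable (F : FinslerStructure n M) (e : OpenPartialHomeomorph M (Coord n)) (x y : Coord n)

/-- The components `g_ij(x, y)` of the fundamental tensor. -/
def g : Matrix (Fin n) (Fin n) ℝ := fundMatrix F.toFun e x y

/-- The Cartan tensor `A_ijk = (F/2) ∂g_ij/∂yᵏ`. -/
def cartan (i j k : Fin n) : ℝ :=
  localRep F.toFun e x y / 2 * pd k (fun y' => F.g e x y' i j) y

/-- The Cartan tensor with the first index raised, `Aⁱ_jk = gⁱˡ A_ljk`. -/
def cartanUp (i j k : Fin n) : ℝ := ∑ l, (F.g e x y)⁻¹ i l * F.cartan e x y l j k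

/-- The formal Christoffel symbols
`γⁱ_jk(x, y) = ½ gⁱˢ (∂g_sj/∂xᵏ - ∂g_jk/∂xˢ + ∂g_sk/∂xʲ)`. -/
def gammaCoeff (i j k : Fin n) : ℝ :=
  1 / 2 * ∑ s, (F.g e x y)⁻¹ i s *
    (pd k (fun x' => F.g e x' y s j) x - pd s (fun x' => F.g e x' y j k) x
      + pd j (fun x' => F.g e x' y s k) x)

/-- The spray coefficients `Gⁱ(x, y) = γⁱ_sk(x, y) yˢ yᵏ`. -/
def spray (i : Fin n) : ℝ := ∑ s, ∑ k, F.gammaCoeff e x y i s k * y s * y k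

/-- The coefficients `Nⁱ_j = γⁱ_jk yᵏ - Aⁱ_jk γᵏ_rs yʳ yˢ / F` of the non-linear connection used
for the Chern connection. -/
def nonlin (i j : Fin n) : ℝ :=
  ∑ k, F.gammaCoeff e x y i j k * y k
    - ∑ k, F.cartanUp e x y i j k *
        (∑ r, ∑ s, F.gammaCoeff e x y k r s * y r * y s) / localRep F.toFun e x y

/-- The horizontal derivative `δg_ij/δxᵏ = ∂g_ij/∂xᵏ - Nᵐ_k ∂g_ij/∂yᵐ`. -/
def deltaG (k i j : Fin n) : ℝ :=
  pd k (fun x' => F.g e x' y i j) x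
    - ∑ m, F.nonlin e x y m k * pd m (fun y' => F.g e x y' i j) y

/-- The coefficients of the Chern connection,
`Γⁱ_jk = ½ gⁱˢ (δg_sj/δxᵏ - δg_jk/δxˢ + δg_sk/δxʲ)`.
By `chernCoeff_unique` below they are the only solution of the two structure equations (no torsion,
almost `g`-compatibility) of the Chern connection. -/
def chernCoeff : ConnCoeff n M := fun e x y i j k =>
  1 / 2 * ∑ s, (F.g e x y)⁻¹ i s *
    (F.deltaG e x y k s j - F.deltaG e x y s j k + F.deltaG e x y j s k)

section ChernUnique

variable {F : FinslerStructure n M} {e : OpenPartialHomeomorph M (Coord n)} {x y : Coord n}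

theorem g_symm (he : e ∈ IsManifold.maximalAtlas (𝓡 n) ∞ M) (hx : x ∈ e.target) (hy : y ≠ 0)
    (i j : Fin n) : F.g e x y i j = F.g e x y j i := by
  have h := (F.posDef e he x hx y hy).isHermitian.apply i j
  simpa [g] using h.symm

theorem deltaG_symm (he : e ∈ IsManifold.maximalAtlas (𝓡 n) ∞ M) (hx : x ∈ e.target) (hy : y ≠ 0)
    (k i j : Fin n) : F.deltaG e x y k i j = F.deltaG e x y k j i := by
  have h1 : (fun x' => F.g e x' y i j) =ᶠ[nhds x] fun x' => F.g e x' y j i := by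
    filter_upwards [e.open_target.mem_nhds hx] with x' hx' using g_symm he hx' hy i j
  have h2 : (fun y' => F.g e x y' i j) =ᶠ[nhds y] fun y' => F.g e x y' j i := by
    filter_upwards [isOpen_ne.mem_nhds hy] with y' hy' using g_symm he hx hy' i j
  simp only [deltaG, pd, h1.fderiv_eq, h2.fderiv_eq]

/-- The Chern coefficients are the only solution of the structure equations
`dxʲ ∧ ωⁱ_j = 0` and `dg_ij - g_kj ωᵏ_i - g_ik ωᵏ_j = 2 A_ijk δyᵏ / F`, which for
`ωⁱ_j = Γⁱ_jk dxᵏ` say that `Γⁱ_jk = Γⁱ_kj` and `δg_ij/δxᵏ = g_lj Γˡ_ik + g_il Γˡ_jk`. -/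
theorem chernCoeff_unique (he : e ∈ IsManifold.maximalAtlas (𝓡 n) ∞ M) (hx : x ∈ e.target)
    (hy : y ≠ 0) (Γ : Fin n → Fin n → Fin n → ℝ) :
    ((∀ i j k, Γ i j k = Γ i k j) ∧
      ∀ i j k, F.deltaG e x y k i j
        = ∑ l, (F.g e x y l j * Γ l i k + F.g e x y i l * Γ l j k)) ↔
    Γ = F.chernCoeff e x y := by
  have hdet : IsUnit (F.g e x y).det := (F.posDef e he x hx y hy).det_pos.ne'.isUnit
  have hs := g_symm (F := F) he hx hy
  have hD := deltaG_symm (F := F) he hx hy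
  have hinv : ∀ v : Fin n → ℝ, ∀ i, ∑ s, (F.g e x y)⁻¹ i s * ∑ l, F.g e x y s l * v l = v i := by
    intro v i
    have := congrFun (Matrix.mulVec_mulVec v (F.g e x y)⁻¹ (F.g e x y)) i
    rw [Matrix.nonsing_inv_mul _ hdet, Matrix.one_mulVec] at this
    simpa [Matrix.mulVec, dotProduct] using this
  have hinv' : ∀ v : Fin n → ℝ, ∀ i, ∑ s, F.g e x y i s * ∑ l, (F.g e x y)⁻¹ s l * v l = v i := by
    intro v i
    have := congrFun (Matrix.mulVec_mulVec v (F.g e x y) (F.g e x y)⁻¹) i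
    rw [Matrix.mul_nonsing_inv _ hdet, Matrix.one_mulVec] at this
    simpa [Matrix.mulVec, dotProduct] using this
  constructor
  · rintro ⟨hsym, hcomp⟩
    funext i j k
    have key : ∀ s, F.deltaG e x y k s j - F.deltaG e x y s j k + F.deltaG e x y j s k
        = 2 * ∑ l, F.g e x y s l * Γ l j k := by
      intro s
      rw [hcomp, hcomp, hcomp, ← Finset.sum_sub_distrib, ← Finset.sum_add_distrib, Finset.mul_sum]
      refine Finset.sum_congr rfl fun l _ => ?_
      rw [hs j l, hsym l k j, hsym l j s, hsym l k s]
      ring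
    simp only [chernCoeff, key]
    rw [← hinv (fun l => Γ l j k) i, Finset.mul_sum]
    refine Finset.sum_congr rfl fun l _ => ?_
    ring
  · rintro rfl
    refine ⟨fun i j k => ?_, fun i j k => ?_⟩
    · simp only [chernCoeff]
      congr 1
      refine Finset.sum_congr rfl fun s _ => ?_
      rw [hD s k j]
      ring
    · have low : ∀ i j k, ∑ l, F.g e x y i l * F.chernCoeff e x y l j k = 1 / 2 *
          (F.deltaG e x y k i j - F.deltaG e x y i j k + F.deltaG e x y j i k) := by
        intro i j k
        rw [← hinv' (fun s => F.deltaG e x y k s j - F.deltaG e x y s j k + F.deltaG e x y j s k) i,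
          Finset.mul_sum]
        refine Finset.sum_congr rfl fun s _ => ?_
        simp only [chernCoeff]
        ring
      rw [Finset.sum_add_distrib, low i j k]
      simp only [fun l => hs l j, low j i k]
      rw [hD k j i]
      ring

end ChernUnique

/-- The coefficients `ᶜNⁱ_j = ½ ∂Gⁱ/∂yʲ` of the non-linear connection of Cartan type. -/
def cartanNonlin (i j : Fin n) : ℝ := 1 / 2 * pd j (fun y' => F.spray e x y' i) y

/-- The coefficients `ᵇΓⁱ_jk = ∂(ᶜNⁱ_j)/∂yᵏ = ½ ∂²Gⁱ/∂yʲ∂yᵏ` of the linear Berwald connection. -/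
def berwaldCoeff : ConnCoeff n M := fun e x y i j k =>
  pd k (fun y' => F.cartanNonlin e x y' i j) y

/-- The Finsler structure is Berwald: the coefficients of the Chern connection live on `M`, that
is, in natural coordinates they do not depend on `y ≠ 0`. -/
def IsBerwald (F : FinslerStructure n M) : Prop :=
  ∀ e ∈ IsManifold.maximalAtlas (𝓡 n) ∞ M, ∀ x ∈ e.target, ∀ y y' : Coord n, y ≠ 0 → y' ≠ 0 →
    F.chernCoeff e x y = F.chernCoeff e x y'

end FinslerStructure

variable (n M) in
/-- Smooth Riemannian metrics on `M`. -/
abbrev RiemMetric : Type _ :=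
  ContMDiffRiemannianMetric (𝓡 n) ∞ (Coord n) (fun p : M => TangentSpace (𝓡 n) p)

namespace RiemMetric

/-- The components `h_ij(x) = h(∂/∂xⁱ, ∂/∂xʲ)` of a Riemannian metric in the chart `e`. -/
def comp (h : RiemMetric n M) (e : OpenPartialHomeomorph M (Coord n)) (x : Coord n) :
    Matrix (Fin n) (Fin n) ℝ :=
  Matrix.of fun i j => h.inner (e.symm x)
    (mfderiv (𝓡 n) (𝓡 n) e.symm x (EuclideanSpace.single i (1 : ℝ)))
    (mfderiv (𝓡 n) (𝓡 n) e.symm x (EuclideanSpace.single j (1 : ℝ)))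

/-- The Christoffel symbols
`ʰΓⁱ_jk(x) = ½ hⁱˢ (∂h_sj/∂xᵏ - ∂h_jk/∂xˢ + ∂h_sk/∂xʲ)` of the Levi-Civita connection of `h`,
which are also the coefficients of its pull-back to `π*TM` and do not depend on `y`. -/
def leviCivitaCoeff (h : RiemMetric n M) : ConnCoeff n M := fun e x _ i j k =>
  1 / 2 * ∑ s, (comp h e x)⁻¹ i s *
    (pd k (fun x' => comp h e x' s j) x - pd s (fun x' => comp h e x' j k) x
      + pd j (fun x' => comp h e x' s k) x)

end RiemMetric

/-- The `C²` curve `c`, defined on the open interval `J`, is a (regular, parametrized) geodesic of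
the connection with coefficients `Γ`: in every chart its coordinate expression `X = e ∘ c` has
non-zero velocity (so that `(X, X')` lies in the slit tangent bundle, where `Γ` is defined) and
satisfies `d²Xⁱ/dt² + Γⁱ_jk(X, dX/dt) dXʲ/dt dXᵏ/dt = 0`. -/
def IsGeodesicOn (Γ : ConnCoeff n M) (c : ℝ → M) (J : Set ℝ) : Prop :=
  ContMDiffOn 𝓘(ℝ, ℝ) (𝓡 n) 2 c J ∧
  ∀ e ∈ IsManifold.maximalAtlas (𝓡 n) ∞ M, ∀ t ∈ J, c t ∈ e.source →
    deriv (fun s => e (c s)) t ≠ 0 ∧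
    ∀ i, deriv (deriv fun s => e (c s)) t i
      + ∑ j, ∑ k, Γ e (e (c t)) (deriv (fun s => e (c s)) t) i j k
          * deriv (fun s => e (c s)) t j * deriv (fun s => e (c s)) t k = 0

/-- Two connections have the same parametrized geodesics. -/
def SameGeodesics (Γ₁ Γ₂ : ConnCoeff n M) : Prop :=
  ∀ (J : Set ℝ), IsOpen J → J.OrdConnected → ∀ c : ℝ → M,
    IsGeodesicOn Γ₁ c J ↔ IsGeodesicOn Γ₂ c J

/-- The Riemannian metric `h` is affinely equivalent to the Finsler structure `F`: its Levi-Civita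
connection has the same parametrized geodesics as the linear Berwald connection of `F`. -/
def AffinelyEquivalent (h : RiemMetric n M) (F : FinslerStructure n M) : Prop :=
  SameGeodesics h.leviCivitaCoeff F.berwaldCoeff

end Connections

end Finsler

end

noncomputable section

open scoped Topology
set_option linter.unusedSectionVars false

namespace Finsler

/-! ### Charts, coordinate frames and coordinate changes. -/

section Charts

variable {n : ℕ} {M : Type*} [TopologicalSpace M] [ChartedSpace (Coord n) M]
  [IsManifold (𝓡 n) ∞ M]
  {e e' : OpenPartialHomeomorph M (Coord n)}

/-! Write `E = F²`. Both directions rest on identities valid for every Finsler structure. The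
non-linear connection satisfies `Nⁱ_j = ½ ∂Gⁱ/∂yʲ` (`cartanNonlin_eq_nonlin`), `yʲ Nⁱ_j = Gⁱ`
(`sum_coord_mul_nonlin`) and `δE/δxᵏ = 0` (`dX_energy_eq`). Consequently the linear Berwald
connection contracted twice with `y` returns `Gⁱ` (`sum_berwaldCoeff`), so its geodesics are the
regular solutions of `ẍ + G(x, ẋ) = 0`.

Let `h` be affinely equivalent to `F`. Every `(x, y)` with `y ≠ 0` is the initial velocity of an
`h`-geodesic. Comparing the two geodesic equations at that instant gives `Gⁱ = ʰΓⁱ_jk yʲ yᵏ`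
(`spray_eq_of_affinelyEquivalent`), so the spray is quadratic and `N` is linear in `y`.
Differentiating `δE/δxᵏ = 0` twice along the fibre then yields the compatibility equation of the
Chern connection for `ʰΓ`. Uniqueness identifies the Chern coefficients with `ʰΓ`, which do not
depend on `y` (`chernCoeff_eq_of_spray_eq`).

Conversely, let `F` be Berwald with Chern coefficients `Γ(x)`. Then `N` is linear in `y`, and the
linear Berwald coefficients are `Γ` as well. A metric parallel for `Γ` comes from averaging over the
fibres: `h(u, v) = ∫ χ(E) dE(u) dE(v) dy / ∫ χ(E) dy`, where `dE` is the fibre derivative and `χ` a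
bump function vanishing near `0` and `∞`. The horizontal flow is linear on fibres and preserves `E`,
hence transports the integrands. It distorts Lebesgue measure only through the trace of `Γ`, which
cancels in the quotient (`pd_meanForm`). The same quotient cancels the Jacobian of a coordinate
change, so `h` is globally defined (`meanForm_transition`). Since `Γ` is torsion-free and metric for
`h`, it is the Levi-Civita connection of `h`, and the geodesics agree. -/

theorem mdifferentiableAt_chart_symm (he : e ∈ IsManifold.maximalAtlas (𝓡 n) ∞ M)
    {x : Coord n} (hx : x ∈ e.target) : MDifferentiableAt (𝓡 n) (𝓡 n) e.symm x :=
  ((contMDiffOn_symm_of_mem_maximalAtlas he).contMDiffAt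
    (e.open_target.mem_nhds hx)).mdifferentiableAt (by simp)

theorem mdifferentiableAt_chart (he : e ∈ IsManifold.maximalAtlas (𝓡 n) ∞ M)
    {p : M} (hp : p ∈ e.source) : MDifferentiableAt (𝓡 n) (𝓡 n) e p :=
  ((contMDiffOn_of_mem_maximalAtlas he).contMDiffAt
    (e.open_source.mem_nhds hp)).mdifferentiableAt (by simp)

theorem chart_mdifferentiable (he : e ∈ IsManifold.maximalAtlas (𝓡 n) ∞ M) :
    e.MDifferentiable (𝓡 n) (𝓡 n) :=
  ⟨fun _ hp => (mdifferentiableAt_chart he hp).mdifferentiableWithinAt,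
    fun _ hx => (mdifferentiableAt_chart_symm he hx).mdifferentiableWithinAt⟩

/-- The derivative of the inverse of a chart, as a linear endomorphism of the coordinate space,
with which the tangent space is identified. -/
def frame (e : OpenPartialHomeomorph M (Coord n)) (x : Coord n) : Coord n →L[ℝ] Coord n :=
  mfderiv (𝓡 n) (𝓡 n) e.symm x

theorem frame_injective (he : e ∈ IsManifold.maximalAtlas (𝓡 n) ∞ M)
    {x : Coord n} (hx : x ∈ e.target) : Function.Injective (frame e x) :=
  (chart_mdifferentiable he).symm.mfderiv_injective (x := x) hx

theorem frame_ne_zero (he : e ∈ IsManifold.maximalAtlas (𝓡 n) ∞ M)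
    {x y : Coord n} (hx : x ∈ e.target) (hy : y ≠ 0) : frame e x y ≠ 0 := fun h =>
  hy (frame_injective he hx (by rw [h, map_zero]))

/-- This map is the tangent map of `e.symm`, up to the identification of `T(ℝⁿ)` with `ℝⁿ × ℝⁿ`. It
carries smoothness of `F` and of bundle sections over to coordinates. -/
theorem contMDiffOn_natPoint (he : e ∈ IsManifold.maximalAtlas (𝓡 n) ∞ M) :
    ContMDiffOn 𝓘(ℝ, Coord n × Coord n) (𝓡 n).tangent ∞
      (fun q : Coord n × Coord n => natPoint e q.1 q.2) (e.target ×ˢ univ) := by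
  have h1 := (contMDiffOn_symm_of_mem_maximalAtlas he).contMDiffOn_tangentMapWithin
    (m := ∞) (by simp) e.open_target.uniqueMDiffOn
  have h2 : ContMDiff 𝓘(ℝ, Coord n × Coord n) (𝓡 n).tangent ∞
      (fun q : Coord n × Coord n => (⟨q.1, q.2⟩ : TangentBundle (𝓡 n) (Coord n))) := by
    intro q
    rw [Bundle.contMDiffAt_totalSpace]
    refine ⟨contDiff_fst.contMDiff.contMDiffAt, ?_⟩
    simpa using contDiff_snd.contMDiff.contMDiffAt
  refine (h1.comp h2.contMDiffOn (s := e.target ×ˢ univ) fun q hq => hq.1).congr fun q hq => ?_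
  simp only [natPoint, tangentMapWithin, Function.comp]
  rw [mfderivWithin_of_isOpen e.open_target hq.1]

theorem natPoint_eq_frame (x y : Coord n) :
    natPoint e x y = ⟨e.symm x, (frame e x y : Coord n)⟩ := rfl

variable (e e') in
/-- The change of coordinates between two charts. -/
def transition (x : Coord n) : Coord n := e' (e.symm x)

theorem contDiffAt_transition (he : e ∈ IsManifold.maximalAtlas (𝓡 n) ∞ M)
    (he' : e' ∈ IsManifold.maximalAtlas (𝓡 n) ∞ M) {x : Coord n} (hx : x ∈ e.target)
    (hx' : e.symm x ∈ e'.source) : ContDiffAt ℝ ∞ (transition e e') x := by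
  rw [← contMDiffAt_iff_contDiffAt]
  exact ((contMDiffOn_of_mem_maximalAtlas he').contMDiffAt (e'.open_source.mem_nhds hx')).comp x
    ((contMDiffOn_symm_of_mem_maximalAtlas he).contMDiffAt (e.open_target.mem_nhds hx))

theorem frame_transition (he : e ∈ IsManifold.maximalAtlas (𝓡 n) ∞ M)
    (he' : e' ∈ IsManifold.maximalAtlas (𝓡 n) ∞ M) {x : Coord n} (hx : x ∈ e.target)
    (hx' : e.symm x ∈ e'.source) (u : Coord n) :
    frame e' (transition e e' x) (fderiv ℝ (transition e e') x u) = frame e x u := by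
  have h1 : e.symm =ᶠ[𝓝 x] e'.symm ∘ transition e e' := by
    have : ∀ᶠ z in 𝓝 x, e.symm z ∈ e'.source :=
      (e.symm.continuousAt hx).eventually_mem (e'.open_source.mem_nhds hx')
    filter_upwards [this] with z hz
    simp [transition, e'.left_inv hz]
  have h2 : MDifferentiableAt (𝓡 n) (𝓡 n) (transition e e') x :=
    ((contDiffAt_transition he he' hx hx').differentiableAt (by simp)).mdifferentiableAt
  have h3 : MDifferentiableAt (𝓡 n) (𝓡 n) e'.symm (transition e e' x) :=
    mdifferentiableAt_chart_symm he' (e'.map_source hx')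
  have h4 : mfderiv (𝓡 n) (𝓡 n) e.symm x = _ := h1.mfderiv_eq.trans (mfderiv_comp x h3 h2)
  have h5 := congrArg (fun T : Coord n →L[ℝ] Coord n => T u) h4
  rw [mfderiv_eq_fderiv] at h5
  exact h5.symm

theorem natPoint_transition (he : e ∈ IsManifold.maximalAtlas (𝓡 n) ∞ M)
    (he' : e' ∈ IsManifold.maximalAtlas (𝓡 n) ∞ M) {x : Coord n} (hx : x ∈ e.target)
    (hx' : e.symm x ∈ e'.source) (y : Coord n) :
    natPoint e' (transition e e' x) (fderiv ℝ (transition e e') x y) = natPoint e x y := by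
  have h1 : e'.symm (transition e e' x) = e.symm x := e'.left_inv hx'
  have := frame_transition he he' hx hx' y
  simp only [natPoint_eq_frame, this]
  rw [h1]

/-- Links the trivializations that define smoothness of sections to derivatives of inverse charts,
in which the components of tensors are written. -/
theorem symmL_eq_frame {p₀ p : M} (hp : p ∈ (chartAt (Coord n) p₀).source) (u : Coord n) :
    (trivializationAt (Coord n) (TangentSpace (𝓡 n)) p₀).symm p u
      = frame (chartAt (Coord n) p₀) (chartAt (Coord n) p₀ p) u := by
  have : IsManifold (𝓡 n) 1 M := IsManifold.of_le (n := ∞) (by simp)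
  have := TangentBundle.symmL_trivializationAt (I := 𝓡 n) hp
  have h2 := congrArg (fun T : Coord n →L[ℝ] Coord n => T u) this
  simp only [frame, ← mfderivWithin_univ]
  refine Eq.trans ?_ (h2.trans ?_)
  · exact (Trivialization.symmL_apply _ (by simpa using hp) u).symm
  · simp

/-- The tangent space at `p` is modelled on the preferred chart at `p`, so that chart induces the
identity there. -/
theorem frame_chartAt_self (p : M) (u : Coord n) :
    frame (chartAt (Coord n) p) (chartAt (Coord n) p p) u = u := by
  have : IsManifold (𝓡 n) 1 M := IsManifold.of_le (n := ∞) (by simp)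
  rw [← symmL_eq_frame (mem_chart_source _ p)]
  have := TangentBundle.symmL_trivializationAt_eq_core (I := 𝓡 n) (mem_chart_source (Coord n) p)
  have h2 := congrArg (fun T : Coord n →L[ℝ] Coord n => T u) this
  exact (Trivialization.symmL_apply _ (by simp) u).symm.trans <| h2.trans ((tangentBundleCore (𝓡 n) M).coordChange_self _ _ (mem_chart_source _ p) _)

end Charts

/-! ### The Finsler function and its square in natural coordinates. -/

section LocalRep

variable {n : ℕ} {M : Type*} [TopologicalSpace M] [ChartedSpace (Coord n) M]
  [IsManifold (𝓡 n) ∞ M]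
  {e : OpenPartialHomeomorph M (Coord n)}

/-- The slit domain of the natural coordinates of the chart `e`. -/
def slit (e : OpenPartialHomeomorph M (Coord n)) : Set (Coord n × Coord n) :=
  e.target ×ˢ {y | y ≠ 0}

theorem isOpen_slit (e : OpenPartialHomeomorph M (Coord n)) : IsOpen (slit e) :=
  e.open_target.prod isOpen_ne

namespace FinslerStructure

variable (F : FinslerStructure n M)

theorem contDiffOn_localRep (he : e ∈ IsManifold.maximalAtlas (𝓡 n) ∞ M) :
    ContDiffOn ℝ ∞ (fun q : Coord n × Coord n => localRep F.toFun e q.1 q.2) (slit e) := by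
  rw [← contMDiffOn_iff_contDiffOn]
  exact F.smooth.comp ((contMDiffOn_natPoint he).mono fun q hq => ⟨hq.1, mem_univ _⟩)
    fun q hq => frame_ne_zero he hq.1 hq.2

theorem localRep_smul (e : OpenPartialHomeomorph M (Coord n)) (x y : Coord n) {c : ℝ}
    (hc : 0 < c) : localRep F.toFun e x (c • y) = c * localRep F.toFun e x y := by
  have := F.homog (e.symm x) (frame e x y) c hc
  simp only [localRep, natPoint_eq_frame, map_smul]
  exact this

/-- The square of the Finsler function in natural coordinates. -/
def energy (F : FinslerStructure n M) (e : OpenPartialHomeomorph M (Coord n))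
    (q : Coord n × Coord n) : ℝ := localRep F.toFun e q.1 q.2 ^ 2

theorem contDiffOn_energy (he : e ∈ IsManifold.maximalAtlas (𝓡 n) ∞ M) :
    ContDiffOn ℝ ∞ (F.energy e) (slit e) :=
  (F.contDiffOn_localRep he).pow 2

theorem energy_smul (e : OpenPartialHomeomorph M (Coord n)) (x y : Coord n) {c : ℝ}
    (hc : 0 < c) : F.energy e (x, c • y) = c ^ 2 * F.energy e (x, y) := by
  simp only [energy, F.localRep_smul e x y hc, mul_pow]

end FinslerStructure

end LocalRep

/-! ### Fields of bilinear forms and their smoothness in charts. -/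

section Metric

variable {n : ℕ} {M : Type*} [TopologicalSpace M] [ChartedSpace (Coord n) M]
  [IsManifold (𝓡 n) ∞ M]
  {e e' : OpenPartialHomeomorph M (Coord n)}

/-- The expression of a field of bilinear forms on the tangent spaces in the chart `e`. -/
def pullForm (B : (p : M) → TangentSpace (𝓡 n) p →L[ℝ] TangentSpace (𝓡 n) p →L[ℝ] ℝ)
    (e : OpenPartialHomeomorph M (Coord n)) (x u v : Coord n) : ℝ :=
  B (e.symm x) (mfderiv (𝓡 n) (𝓡 n) e.symm x u) (mfderiv (𝓡 n) (𝓡 n) e.symm x v)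

theorem pullForm_eq_sum
    (B : (p : M) → TangentSpace (𝓡 n) p →L[ℝ] TangentSpace (𝓡 n) p →L[ℝ] ℝ)
    (e : OpenPartialHomeomorph M (Coord n)) (x u v : Coord n) :
    pullForm B e x u v = ∑ i, ∑ j,
      pullForm B e x (EuclideanSpace.single i 1) (EuclideanSpace.single j 1) * (u i * v j) := by
  let β : Coord n →L[ℝ] Coord n →L[ℝ] ℝ :=
    ContinuousLinearMap.bilinearComp (B (e.symm x)) (frame e x) (frame e x)
  have hβ : ∀ u v, pullForm B e x u v = β u v := fun u v => rfl
  have hs : ∀ w : Coord n, w = ∑ i, w i • EuclideanSpace.single i (1 : ℝ) := fun w => by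
    simpa using ((EuclideanSpace.basisFun (Fin n) ℝ).sum_repr w).symm
  simp only [hβ]
  conv_lhs => rw [hs u, hs v]
  simp only [map_sum, map_smul, sum_apply, smul_apply,
    smul_eq_mul, Finset.mul_sum]
  rw [Finset.sum_comm]
  refine Finset.sum_congr rfl fun i _ => Finset.sum_congr rfl fun j _ => ?_
  ring

theorem RiemMetric.contDiffOn_pullForm (h : RiemMetric n M)
    (he : e ∈ IsManifold.maximalAtlas (𝓡 n) ∞ M) (u v : Coord n) :
    ContDiffOn ℝ ∞ (fun x => pullForm h.inner e x u v) e.target := by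
  rw [← contMDiffOn_iff_contDiffOn]
  have hsec : ∀ w : Coord n, ContMDiffOn (𝓡 n) (𝓡 n).tangent ∞
      (fun x : Coord n => TotalSpace.mk' (Coord n) (E := TangentSpace (𝓡 n)) (e.symm x)
        (mfderiv (𝓡 n) (𝓡 n) e.symm x w)) e.target := fun w =>
    (contMDiffOn_natPoint he).comp (s := e.target) (f := fun x : Coord n => (x, w))
      (contDiff_prodMk_left w).contMDiff.contMDiffOn fun x hx => ⟨hx, mem_univ _⟩
  have hB := h.contMDiff.comp_contMDiffOn (contMDiffOn_symm_of_mem_maximalAtlas he)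
  have := ContMDiffOn.clm_bundle_apply₂ (E₃ := fun _ : M => ℝ) (F₃ := ℝ) hB (hsec u) (hsec v)
  intro x hx
  have hx' := (contMDiffWithinAt_totalSpace).1 (this x hx)
  simpa [pullForm] using hx'.2

theorem contDiffOn_sum_smul_const {V W : Type*} [NormedAddCommGroup V] [NormedSpace ℝ V]
    [NormedAddCommGroup W] [NormedSpace ℝ W] {s : Set W} {ι : Type*} [Fintype ι]
    (c : W → ι → ι → ℝ) (T : ι → ι → V) (hc : ∀ i j, ContDiffOn ℝ ∞ (fun x => c x i j) s) :
    ContDiffOn ℝ ∞ (fun x => ∑ i, ∑ j, c x i j • T i j) s :=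
  ContDiffOn.sum fun i _ => ContDiffOn.sum fun j _ => (hc i j).smul contDiffOn_const

-- Converse to `RiemMetric.contDiffOn_pullForm`: smooth components in all charts give a smooth
-- section. It supplies the smoothness field of the averaged metric.
set_option synthInstance.maxHeartbeats 200000 in
set_option maxHeartbeats 1000000 in
theorem contMDiff_section_of_pullForm
    (B : (p : M) → TangentSpace (𝓡 n) p →L[ℝ] TangentSpace (𝓡 n) p →L[ℝ] ℝ)
    (hB : ∀ e ∈ IsManifold.maximalAtlas (𝓡 n) ∞ M, ∀ i j : Fin n,
      ContDiffOn ℝ ∞ (fun x => pullForm B e x (EuclideanSpace.single i 1)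
        (EuclideanSpace.single j 1)) e.target) :
    ContMDiff (𝓡 n) ((𝓡 n).prod 𝓘(ℝ, Coord n →L[ℝ] Coord n →L[ℝ] ℝ)) ∞
      (fun p => TotalSpace.mk' (Coord n →L[ℝ] Coord n →L[ℝ] ℝ)
        (E := fun p : M => TangentSpace (𝓡 n) p →L[ℝ] TangentSpace (𝓡 n) p →L[ℝ] ℝ) p (B p)) := by
  intro p₀
  rw [contMDiffAt_hom_bundle]
  refine ⟨contMDiffAt_id, ?_⟩
  set e := chartAt (Coord n) p₀ with he_def
  have he : e ∈ IsManifold.maximalAtlas (𝓡 n) ∞ M := IsManifold.chart_mem_maximalAtlas p₀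
  have hp₀ : p₀ ∈ e.source := mem_chart_source _ p₀
  let T : Fin n → Fin n → (Coord n →L[ℝ] Coord n →L[ℝ] ℝ) := fun i j =>
    (EuclideanSpace.proj (𝕜 := ℝ) i : Coord n →L[ℝ] ℝ).smulRight
      (EuclideanSpace.proj (𝕜 := ℝ) j : Coord n →L[ℝ] ℝ)
  -- `K ∘ e` is the expression of the section in the trivialization at `p₀`, reassembled from its
  -- components.
  let K : Coord n → (Coord n →L[ℝ] Coord n →L[ℝ] ℝ) := fun x =>
    ∑ i, ∑ j, pullForm B e x (EuclideanSpace.single i 1) (EuclideanSpace.single j 1) • T i j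
  have hK : ContDiffOn ℝ ∞ K e.target :=
    contDiffOn_sum_smul_const (fun x i j => pullForm B e x (EuclideanSpace.single i 1)
      (EuclideanSpace.single j 1)) T (hB e he)
  have h1 : ContMDiffAt (𝓡 n) 𝓘(ℝ, Coord n →L[ℝ] Coord n →L[ℝ] ℝ) ∞ (K ∘ e) p₀ :=
    ((hK.contDiffAt (e.open_target.mem_nhds (e.map_source hp₀))).contMDiffAt).comp p₀
      ((contMDiffOn_of_mem_maximalAtlas he).contMDiffAt (e.open_source.mem_nhds hp₀))
  refine h1.congr_of_eventuallyEq ?_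
  filter_upwards [e.open_source.mem_nhds hp₀] with p hp
  have hb : p ∈ (trivializationAt (Coord n) (TangentSpace (𝓡 n)) p₀).baseSet := by
    simpa using hp
  ext u v
  rw [inCoordinates_apply_eq₂ hb hb (mem_univ _), symmL_eq_frame hp, symmL_eq_frame hp]
  have h2 : B p (frame e (e p) u) (frame e (e p) v) = pullForm B e (e p) u v := by
    simp only [pullForm]
    rw [e.left_inv hp]
    rfl
  simp only [Function.comp, K]
  rw [pullForm_eq_sum] at h2
  simp [T, sum_apply]
  exact h2

end Metric
end Finsler

/-! ### Calculus on the coordinate space of pairs `(x, y)`. -/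

namespace Finsler

section Calculus

variable {n : ℕ} {S : Set (Coord n × Coord n)} {f g : Coord n × Coord n → ℝ}
  {q w w' : Coord n × Coord n}

/-- The derivative in the direction `w` of a function of the natural coordinates `(x, y)`. -/
def dirDeriv (w : Coord n × Coord n) (f : Coord n × Coord n → ℝ) (q : Coord n × Coord n) : ℝ :=
  fderiv ℝ f q w

/-- The partial derivative `∂/∂xᵏ`. -/
def dX (k : Fin n) (f : Coord n × Coord n → ℝ) : Coord n × Coord n → ℝ :=
  dirDeriv (EuclideanSpace.single k 1, 0) f

/-- The partial derivative `∂/∂yᵏ`. -/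
def dY (k : Fin n) (f : Coord n × Coord n → ℝ) : Coord n × Coord n → ℝ :=
  dirDeriv (0, EuclideanSpace.single k 1) f

theorem ContDiffOn.differentiableAt_of_isOpen (hf : ContDiffOn ℝ ∞ f S) (hS : IsOpen S)
    (hq : q ∈ S) : DifferentiableAt ℝ f q :=
  (hf.contDiffAt (hS.mem_nhds hq)).differentiableAt (by simp)

theorem contDiffOn_dirDeriv (hf : ContDiffOn ℝ ∞ f S) (hS : IsOpen S) (w : Coord n × Coord n) :
    ContDiffOn ℝ ∞ (dirDeriv w f) S :=
  (hf.fderiv_of_isOpen hS (by simp)).clm_apply contDiffOn_const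

theorem dirDeriv_comm (hf : ContDiffOn ℝ ∞ f S) (hS : IsOpen S) (hq : q ∈ S) :
    dirDeriv w (dirDeriv w' f) q = dirDeriv w' (dirDeriv w f) q := by
  have h1 : ContDiffAt ℝ ∞ f q := hf.contDiffAt (hS.mem_nhds hq)
  have h2 : IsSymmSndFDerivAt ℝ f q := h1.isSymmSndFDerivAt (by
    rw [minSmoothness_of_isRCLikeNormedField]; exact WithTop.coe_le_coe.2 le_top)
  have h3 : DifferentiableAt ℝ (fderiv ℝ f) q :=
    (h1.fderiv_right (m := ∞) (by simp)).differentiableAt (by simp)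
  have h4 : ∀ v v', dirDeriv v (dirDeriv v' f) q = fderiv ℝ (fderiv ℝ f) q v v' := by
    intro v v'
    unfold dirDeriv
    rw [fderiv_clm_apply h3 (differentiableAt_const _)]
    simp
  rw [h4, h4]
  exact h2 w w'

theorem dirDeriv_congr (hS : IsOpen S) (h : EqOn f g S) (hq : q ∈ S) :
    dirDeriv w f q = dirDeriv w g q := by
  unfold dirDeriv
  rw [Filter.EventuallyEq.fderiv_eq (h.eventuallyEq_of_mem (hS.mem_nhds hq))]

theorem dirDeriv_const_mul (hf : DifferentiableAt ℝ f q) (c : ℝ) :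
    dirDeriv w (fun q => c * f q) q = c * dirDeriv w f q := by
  simp only [dirDeriv, fderiv_const_mul hf]
  simp

theorem dirDeriv_sub (hf : DifferentiableAt ℝ f q) (hg : DifferentiableAt ℝ g q) :
    dirDeriv w (fun q => f q - g q) q = dirDeriv w f q - dirDeriv w g q := by
  simp only [dirDeriv, fderiv_fun_sub hf hg]
  simp

theorem dirDeriv_sum_mul {ι : Type*} [Fintype ι] {a b : ι → Coord n × Coord n → ℝ}
    (ha : ∀ i, DifferentiableAt ℝ (a i) q) (hb : ∀ i, DifferentiableAt ℝ (b i) q) :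
    dirDeriv w (fun q => ∑ i, a i q * b i q) q
      = ∑ i, (dirDeriv w (a i) q * b i q + a i q * dirDeriv w (b i) q) := by
  unfold dirDeriv
  rw [fderiv_fun_sum (A := fun i q => a i q * b i q) fun i _ => (ha i).mul (hb i)]
  rw [sum_apply]
  refine Finset.sum_congr rfl fun i _ => ?_
  rw [fderiv_fun_mul (ha i) (hb i)]
  simp
  ring

theorem contDiff_coord (k : Fin n) : ContDiff ℝ ∞ fun q : Coord n × Coord n => q.2 k := by
  fun_prop

theorem dirDeriv_coord (k : Fin n) : dirDeriv w (fun q : Coord n × Coord n => q.2 k) q = w.2 k := by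
  have : HasFDerivAt (fun q : Coord n × Coord n => q.2 k)
      ((EuclideanSpace.proj k : Coord n →L[ℝ] ℝ).comp
        (ContinuousLinearMap.snd ℝ (Coord n) (Coord n))) q :=
    ContinuousLinearMap.hasFDerivAt
      ((EuclideanSpace.proj k : Coord n →L[ℝ] ℝ).comp
      (ContinuousLinearMap.snd ℝ (Coord n) (Coord n)))
  simp [dirDeriv, this.fderiv]

theorem dirDeriv_sum_coord_mul {a : Fin n → Coord n × Coord n → ℝ}
    (ha : ∀ i, DifferentiableAt ℝ (a i) q) :
    dirDeriv w (fun q => ∑ i, q.2 i * a i q) q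
      = ∑ i, w.2 i * a i q + ∑ i, q.2 i * dirDeriv w (a i) q := by
  rw [dirDeriv_sum_mul (fun i => (contDiff_coord i).differentiable (by simp) q) ha,
    ← Finset.sum_add_distrib]
  simp only [dirDeriv_coord]

theorem dY_sum_coord_mul {a : Fin n → Coord n × Coord n → ℝ}
    (ha : ∀ i, DifferentiableAt ℝ (a i) q) (k : Fin n) :
    dY k (fun q => ∑ i, q.2 i * a i q) q = a k q + ∑ i, q.2 i * dY k (a i) q := by
  simp [dY, dirDeriv_sum_coord_mul ha]

theorem dX_sum_coord_mul {a : Fin n → Coord n × Coord n → ℝ}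
    (ha : ∀ i, DifferentiableAt ℝ (a i) q) (k : Fin n) :
    dX k (fun q => ∑ i, q.2 i * a i q) q = ∑ i, q.2 i * dX k (a i) q := by
  simp [dX, dirDeriv_sum_coord_mul ha]

/-- The definitions freeze one block of variables before differentiating. Passing to derivatives of
functions of the pair `(x, y)` makes mixed partials commute. -/
theorem pd_fst_eq_dX {x y : Coord n} (hf : DifferentiableAt ℝ f (x, y)) (k : Fin n) :
    pd k (fun x' => f (x', y)) x = dX k f (x, y) := by
  have h1 : HasFDerivAt (fun x' : Coord n => (x', y))
      (ContinuousLinearMap.inl ℝ (Coord n) (Coord n)) x := hasFDerivAt_prodMk_left x y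
  have := (hf.hasFDerivAt.comp x h1).fderiv
  simp only [pd, dX, dirDeriv]
  erw [this]
  simp

theorem pd_snd_eq_dY {x y : Coord n} (hf : DifferentiableAt ℝ f (x, y)) (k : Fin n) :
    pd k (fun y' => f (x, y')) y = dY k f (x, y) := by
  have h1 : HasFDerivAt (fun y' : Coord n => (x, y'))
      (ContinuousLinearMap.inr ℝ (Coord n) (Coord n)) y := hasFDerivAt_prodMk_right x y
  have := (hf.hasFDerivAt.comp y h1).fderiv
  simp only [pd, dY, dirDeriv]
  erw [this]
  simp

theorem pd_congr {φ ψ : Coord n → ℝ} {U : Set (Coord n)} (hU : IsOpen U) (h : EqOn φ ψ U)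
    {x : Coord n} (hx : x ∈ U) (k : Fin n) : pd k φ x = pd k ψ x := by
  unfold pd
  rw [Filter.EventuallyEq.fderiv_eq (h.eventuallyEq_of_mem (hU.mem_nhds hx))]

/-- Two functions which agree on a slit fibre have the same derivatives along it. -/
theorem dY_congr_fiber {x y : Coord n} (hf : DifferentiableAt ℝ f (x, y))
    (hg : DifferentiableAt ℝ g (x, y)) (h : ∀ y', y' ≠ 0 → f (x, y') = g (x, y')) (hy : y ≠ 0)
    (k : Fin n) : dY k f (x, y) = dY k g (x, y) := by
  rw [← pd_snd_eq_dY hf, ← pd_snd_eq_dY hg]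
  exact pd_congr isOpen_ne (fun y' hy' => h y' hy') hy k

theorem sum_coord_mul_dY (q : Coord n × Coord n) :
    ∑ k, q.2 k * dY k f q = fderiv ℝ f q (0, q.2) := by
  have h1 : ((0 : Coord n), q.2) = ∑ k, q.2 k • ((0 : Coord n), EuclideanSpace.single k (1 : ℝ)) := by
    have h2 : q.2 = ∑ i, q.2 i • EuclideanSpace.single i (1 : ℝ) := by
      simpa using ((EuclideanSpace.basisFun (Fin n) ℝ).sum_repr q.2).symm
    refine Prod.ext ?_ ?_
    · simp [Prod.fst_sum]
    · simpa [Prod.snd_sum] using h2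
  rw [h1]
  simp only [map_sum, map_smul, smul_eq_mul, dY, dirDeriv]

/-- Euler's relation for functions which are positively homogeneous of degree `r` in `y`. -/
theorem euler_of_homogeneous {x y : Coord n} {r : ℕ} (hf : DifferentiableAt ℝ f (x, y))
    (h : ∀ c : ℝ, 0 < c → f (x, c • y) = c ^ r * f (x, y)) :
    ∑ k, y k * dY k f (x, y) = r * f (x, y) := by
  have h0 := sum_coord_mul_dY (f := f) (x, y)
  simp only at h0
  rw [h0]
  -- Both sides of the homogeneity relation are differentiated in `c` at `c = 1`.
  have h1 : HasDerivAt (fun c : ℝ => (x, c • y)) ((0 : Coord n), y) 1 := by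
    have := (hasDerivAt_id (1 : ℝ)).smul_const y
    simp only [one_smul] at this
    exact (hasDerivAt_const (1 : ℝ) x).prodMk this
  have hf' : HasFDerivAt f (fderiv ℝ f (x, y)) (x, (1 : ℝ) • y) := by
    rw [one_smul]; exact hf.hasFDerivAt
  have h2 := hf'.comp_hasDerivAt (1 : ℝ) h1
  have h3 : HasDerivAt (fun c : ℝ => c ^ r * f (x, y)) (r * f (x, y)) 1 := by
    simpa using (hasDerivAt_pow r (1 : ℝ)).mul_const (f (x, y))
  have h4 : (f ∘ fun c : ℝ => (x, c • y)) =ᶠ[𝓝 1] fun c : ℝ => c ^ r * f (x, y) := by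
    filter_upwards [lt_mem_nhds (zero_lt_one' ℝ)] with c hc using h c hc
  exact h2.unique (h3.congr_of_eventuallyEq h4)

theorem contDiffOn_det {m : ℕ} {A : Coord n × Coord n → Matrix (Fin m) (Fin m) ℝ}
    (hA : ∀ i j, ContDiffOn ℝ ∞ (fun q => A q i j) S) : ContDiffOn ℝ ∞ (fun q => (A q).det) S := by
  simp only [Matrix.det_apply]
  refine ContDiffOn.sum fun σ _ => ?_
  simp only [Units.smul_def, zsmul_eq_mul]
  exact contDiffOn_const.mul (contDiffOn_prod fun i _ => hA _ _)

/-- By Cramer's rule the entries are determinants of matrices with smooth entries, divided by the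
determinant of `A`. -/
theorem contDiffOn_matrix_inv {m : ℕ} {A : Coord n × Coord n → Matrix (Fin m) (Fin m) ℝ}
    (hA : ∀ i j, ContDiffOn ℝ ∞ (fun q => A q i j) S) (hdet : ∀ q ∈ S, (A q).det ≠ 0)
    (i j : Fin m) : ContDiffOn ℝ ∞ (fun q => (A q)⁻¹ i j) S := by
  simp only [Matrix.inv_def, Ring.inverse_eq_inv', Matrix.smul_apply, smul_eq_mul,
    Matrix.adjugate_apply]
  refine ((contDiffOn_det hA).inv hdet).mul (contDiffOn_det fun k l => ?_)
  by_cases hk : k = j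
  · subst hk
    simpa [Matrix.updateRow_self] using contDiffOn_const
  · simpa [Matrix.updateRow_ne hk] using hA k l

end Calculus
end Finsler

/-! ### Identities between the metric, the spray, the non-linear connection and the Chern
connection. -/

namespace Finsler

theorem sum_mul_sum_left_comm {ι κ : Type*} [Fintype ι] [Fintype κ] (a : ι → ℝ) (b : κ → ℝ)
    (c : ι → κ → ℝ) : ∑ i, a i * ∑ k, b k * c i k = ∑ k, b k * ∑ i, a i * c i k := by
  simp only [Finset.mul_sum]
  rw [Finset.sum_comm]
  exact Finset.sum_congr rfl fun k _ => Finset.sum_congr rfl fun i _ => by ring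

theorem differentiableAt_of_slit {n : ℕ} {M : Type*} [TopologicalSpace M]
    [ChartedSpace (Coord n) M] [IsManifold (𝓡 n) ∞ M] {e : OpenPartialHomeomorph M (Coord n)} {f : Coord n × Coord n → ℝ} {q : Coord n × Coord n}
    (hf : ContDiffOn ℝ ∞ f (slit e)) (hq : q ∈ slit e) : DifferentiableAt ℝ f q :=
  ContDiffOn.differentiableAt_of_isOpen hf (isOpen_slit e) hq

namespace FinslerStructure

section Identities

variable {n : ℕ} {M : Type*} [TopologicalSpace M] [ChartedSpace (Coord n) M]
  [IsManifold (𝓡 n) ∞ M] (F : FinslerStructure n M)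
  (e : OpenPartialHomeomorph M (Coord n))

/-- The components of the fundamental tensor as functions of the natural coordinates. -/
def gFun (i j : Fin n) (q : Coord n × Coord n) : ℝ := F.g e q.1 q.2 i j

/-- The derivative `∂F²/∂yⁱ`. -/
def energyDY (i : Fin n) : Coord n × Coord n → ℝ := dY i (F.energy e)

/-- The derivative `∂g_ij/∂yᵏ`. -/
def gDY (i j k : Fin n) : Coord n × Coord n → ℝ := dY k (F.gFun e i j)

/-- The formal Christoffel symbols of the first kind. -/
def lowGamma (l j k : Fin n) (q : Coord n × Coord n) : ℝ :=
  1 / 2 * (dX k (F.gFun e l j) q - dX l (F.gFun e j k) q + dX j (F.gFun e l k) q)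

/-- The spray with lowered index. -/
def lowSpray (l : Fin n) (q : Coord n × Coord n) : ℝ :=
  ∑ k, q.2 k * ∑ j, q.2 j * F.lowGamma e l j k q

variable {F e} {q : Coord n × Coord n} (he : e ∈ IsManifold.maximalAtlas (𝓡 n) ∞ M)

include he

theorem contDiffOn_energyDY (i : Fin n) : ContDiffOn ℝ ∞ (F.energyDY e i) (slit e) :=
  contDiffOn_dirDeriv (F.contDiffOn_energy he) (isOpen_slit e) _

theorem gFun_eq (hq : q ∈ slit e) (i j : Fin n) :
    F.gFun e i j q = 1 / 2 * dY i (F.energyDY e j) q := by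
  obtain ⟨x, y⟩ := q
  have h1 : EqOn (fun y' => pd j (fun y'' => localRep F.toFun e x y'' ^ 2) y')
      (fun y' => F.energyDY e j (x, y')) {y | y ≠ 0} := fun y' hy' =>
    pd_snd_eq_dY (f := F.energy e) (differentiableAt_of_slit (q := (x, y'))
      (F.contDiffOn_energy he) ⟨hq.1, hy'⟩) j
  simp only [gFun, g, fundMatrix, Matrix.of_apply]
  rw [pd_congr isOpen_ne h1 hq.2, pd_snd_eq_dY
    (differentiableAt_of_slit (contDiffOn_energyDY he j) hq)]

theorem contDiffOn_gFun (i j : Fin n) : ContDiffOn ℝ ∞ (F.gFun e i j) (slit e) :=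
  (contDiffOn_const.mul (contDiffOn_dirDeriv (contDiffOn_energyDY he j) (isOpen_slit e) _)).congr
    fun _ hq => gFun_eq he hq i j

theorem gFun_symm (hq : q ∈ slit e) (i j : Fin n) : F.gFun e i j q = F.gFun e j i q :=
  g_symm he hq.1 hq.2 i j

theorem gDY_eq (hq : q ∈ slit e) (i j k : Fin n) :
    F.gDY e i j k q = 1 / 2 * dY k (dY i (F.energyDY e j)) q := by
  have h1 : ContDiffOn ℝ ∞ (dY i (F.energyDY e j)) (slit e) :=
    contDiffOn_dirDeriv (contDiffOn_energyDY he j) (isOpen_slit e) _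
  simp only [gDY, dY]
  rw [dirDeriv_congr (isOpen_slit e) (fun q hq => gFun_eq he hq i j) hq]
  exact dirDeriv_const_mul (differentiableAt_of_slit h1 hq) _

theorem gDY_swap_left (hq : q ∈ slit e) (i j k : Fin n) : F.gDY e i j k q = F.gDY e j i k q :=
  dirDeriv_congr (isOpen_slit e) (fun _ hq => gFun_symm he hq i j) hq

/-- `∂g_ij/∂yᵏ` is half a third fibre derivative of `F²`. With `gDY_swap_left` this gives total
symmetry. -/
theorem gDY_swap_right (hq : q ∈ slit e) (i j k : Fin n) : F.gDY e i j k q = F.gDY e k j i q := by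
  rw [gDY_eq he hq, gDY_eq he hq]
  congr 1
  exact dirDeriv_comm (contDiffOn_energyDY he j) (isOpen_slit e) hq

theorem sum_coord_mul_energyDY (hq : q ∈ slit e) :
    ∑ k, q.2 k * F.energyDY e k q = 2 * F.energy e q := by
  simpa [energyDY] using euler_of_homogeneous (r := 2) (differentiableAt_of_slit (F.contDiffOn_energy he) hq) fun c hc => F.energy_smul e q.1 q.2 hc

/-- This is Euler's relation `yᵏ ∂E/∂yᵏ = 2E` for `E = F²`, differentiated once in `yⁱ`. -/
theorem sum_coord_mul_gFun (hq : q ∈ slit e) (i : Fin n) :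
    ∑ j, q.2 j * F.gFun e i j q = 1 / 2 * F.energyDY e i q := by
  have h1 : dY i (fun q => ∑ k, q.2 k * F.energyDY e k q) q = dY i (fun q => 2 * F.energy e q) q :=
    dirDeriv_congr (isOpen_slit e) (fun q hq => sum_coord_mul_energyDY he hq) hq
  rw [dY_sum_coord_mul fun k => differentiableAt_of_slit (contDiffOn_energyDY he k) hq] at h1
  have h2 : dY i (fun q => 2 * F.energy e q) q = 2 * F.energyDY e i q :=
    dirDeriv_const_mul (differentiableAt_of_slit (F.contDiffOn_energy he) hq) 2
  rw [h2] at h1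
  simp only [gFun_eq he hq, mul_left_comm _ (1 / 2 : ℝ), ← Finset.mul_sum]
  linarith

theorem sum_coord_mul_gFun_left (hq : q ∈ slit e) (i : Fin n) :
    ∑ j, q.2 j * F.gFun e j i q = 1 / 2 * F.energyDY e i q := by
  simp only [← sum_coord_mul_gFun he hq i, gFun_symm he hq i]

/-- Only non-negativity of `F` is part of the structure. Strict positivity follows from `g_ij yⁱ yʲ
= F²` and positive definiteness. -/
theorem energy_pos (hq : q ∈ slit e) : 0 < F.energy e q := by
  have h1 := (F.posDef e he q.1 hq.1 q.2 hq.2).dotProduct_mulVec_pos (x := q.2)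
    (fun h => hq.2 (by ext i; exact congrFun h i))
  have h2 : ∑ i, q.2 i * ∑ j, q.2 j * F.gFun e i j q = F.energy e q := by
    simp only [sum_coord_mul_gFun he hq, mul_left_comm _ (1 / 2 : ℝ), ← Finset.mul_sum,
      sum_coord_mul_energyDY he hq]
    ring
  rw [← h2]
  simpa [Matrix.mulVec, dotProduct, gFun, g, mul_comm] using h1

theorem sum_coord_mul_dX_gFun (hq : q ∈ slit e) (i k : Fin n) :
    ∑ j, q.2 j * dX k (F.gFun e i j) q = 1 / 2 * dX k (F.energyDY e i) q := by
  rw [← dX_sum_coord_mul fun j => differentiableAt_of_slit (contDiffOn_gFun he i j) hq]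
  refine (dirDeriv_congr (isOpen_slit e) (fun q hq => sum_coord_mul_gFun he hq i) hq).trans ?_
  exact dirDeriv_const_mul (differentiableAt_of_slit (contDiffOn_energyDY he i) hq) _

theorem dX_gFun_symm (hq : q ∈ slit e) (i j k : Fin n) :
    dX k (F.gFun e i j) q = dX k (F.gFun e j i) q :=
  dirDeriv_congr (isOpen_slit e) (fun _ hq => gFun_symm he hq i j) hq

theorem sum_coord_mul_dX_energyDY (hq : q ∈ slit e) (k : Fin n) :
    ∑ j, q.2 j * dX k (F.energyDY e j) q = 2 * dX k (F.energy e) q := by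
  rw [← dX_sum_coord_mul fun j => differentiableAt_of_slit (contDiffOn_energyDY he j) hq]
  refine (dirDeriv_congr (isOpen_slit e) (fun q hq => sum_coord_mul_energyDY he hq) hq).trans ?_
  exact dirDeriv_const_mul (differentiableAt_of_slit (F.contDiffOn_energy he) hq) _

/-- Differentiating `g_ij yʲ = ½ ∂F²/∂yⁱ` in `yᵏ` produces `g_ik` on both sides. This is why Cartan
terms disappear on contraction with `y`. -/
theorem sum_coord_mul_gDY_middle (hq : q ∈ slit e) (i k : Fin n) :
    ∑ j, q.2 j * F.gDY e i j k q = 0 := by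
  have h1 : dY k (fun q => ∑ j, q.2 j * F.gFun e i j q) q
      = dY k (fun q => 1 / 2 * F.energyDY e i q) q :=
    dirDeriv_congr (isOpen_slit e) (fun q hq => sum_coord_mul_gFun he hq i) hq
  rw [dY_sum_coord_mul fun j => differentiableAt_of_slit (contDiffOn_gFun he i j) hq] at h1
  have h2 : dY k (fun q => 1 / 2 * F.energyDY e i q) q = 1 / 2 * dY k (F.energyDY e i) q :=
    dirDeriv_const_mul (differentiableAt_of_slit (contDiffOn_energyDY he i) hq) _
  rw [h2, ← gFun_eq he hq, gFun_symm he hq k i] at h1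
  simpa [gDY] using h1

theorem sum_coord_mul_gDY_left (hq : q ∈ slit e) (j k : Fin n) :
    ∑ i, q.2 i * F.gDY e i j k q = 0 := by
  rw [← sum_coord_mul_gDY_middle (F := F) he hq j k]
  simp only [gDY_swap_left he hq j]

theorem pd_gFun_fst (hq : q ∈ slit e) (i j k : Fin n) :
    pd k (fun x' => F.g e x' q.2 i j) q.1 = dX k (F.gFun e i j) q :=
  pd_fst_eq_dX (f := F.gFun e i j)
    (differentiableAt_of_slit (contDiffOn_gFun he i j) hq) k

theorem pd_gFun_snd (hq : q ∈ slit e) (i j k : Fin n) :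
    pd k (fun y' => F.g e q.1 y' i j) q.2 = F.gDY e i j k q :=
  pd_snd_eq_dY (f := F.gFun e i j)
    (differentiableAt_of_slit (contDiffOn_gFun he i j) hq) k

theorem isUnit_det (hq : q ∈ slit e) : IsUnit (F.g e q.1 q.2).det :=
  (F.posDef e he q.1 hq.1 q.2 hq.2).det_pos.ne'.isUnit

theorem lower_raise (hq : q ∈ slit e) (v : Fin n → ℝ) (l : Fin n) :
    ∑ i, F.gFun e l i q * ∑ s, (F.g e q.1 q.2)⁻¹ i s * v s = v l := by
  have := congrFun (Matrix.mulVec_mulVec v (F.g e q.1 q.2) (F.g e q.1 q.2)⁻¹) l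
  rw [Matrix.mul_nonsing_inv _ (isUnit_det he hq), Matrix.one_mulVec] at this
  simpa [Matrix.mulVec, dotProduct, gFun] using this

/-- Identities with an upper index are checked after lowering it with `g`: the inverse matrix then
disappears and only derivatives of `F²` remain. -/
theorem eq_of_lower_eq (hq : q ∈ slit e) {v w : Fin n → ℝ}
    (h : ∀ l, ∑ i, F.gFun e l i q * v i = ∑ i, F.gFun e l i q * w i) (i : Fin n) : v i = w i := by
  have h1 : (F.g e q.1 q.2).mulVec v = (F.g e q.1 q.2).mulVec w := funext fun l => h l
  have h2 := congrArg ((F.g e q.1 q.2)⁻¹.mulVec ·) h1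
  simp only [Matrix.mulVec_mulVec, Matrix.nonsing_inv_mul _ (isUnit_det he hq),
    Matrix.one_mulVec] at h2
  exact congrFun h2 i

theorem gammaCoeff_eq (hq : q ∈ slit e) (i j k : Fin n) :
    F.gammaCoeff e q.1 q.2 i j k = ∑ s, (F.g e q.1 q.2)⁻¹ i s * F.lowGamma e s j k q := by
  simp only [gammaCoeff, pd_gFun_fst he hq, lowGamma, Finset.mul_sum]
  exact Finset.sum_congr rfl fun s _ => by ring

theorem lower_gammaCoeff (hq : q ∈ slit e) (l j k : Fin n) :
    ∑ i, F.gFun e l i q * F.gammaCoeff e q.1 q.2 i j k = F.lowGamma e l j k q := by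
  simp only [gammaCoeff_eq he hq]
  exact lower_raise he hq (fun s => F.lowGamma e s j k q) l

theorem contDiffOn_gInv (i j : Fin n) :
    ContDiffOn ℝ ∞ (fun q : Coord n × Coord n => (F.g e q.1 q.2)⁻¹ i j) (slit e) :=
  contDiffOn_matrix_inv (fun i j => contDiffOn_gFun he i j)
    (fun _ hq => (isUnit_det he hq).ne_zero) i j

theorem contDiffOn_lowGamma (l j k : Fin n) : ContDiffOn ℝ ∞ (F.lowGamma e l j k) (slit e) := by
  have h : ∀ i j k, ContDiffOn ℝ ∞ (dX k (F.gFun e i j)) (slit e) := fun i j k =>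
    contDiffOn_dirDeriv (contDiffOn_gFun he i j) (isOpen_slit e) _
  exact contDiffOn_const.mul (((h _ _ _).sub (h _ _ _)).add (h _ _ _))

theorem contDiffOn_spray (i : Fin n) :
    ContDiffOn ℝ ∞ (fun q : Coord n × Coord n => F.spray e q.1 q.2 i) (slit e) := by
  have h : ∀ s k, ContDiffOn ℝ ∞ (fun q : Coord n × Coord n => F.gammaCoeff e q.1 q.2 i s k)
      (slit e) := fun s k =>
    (ContDiffOn.sum fun t _ => (contDiffOn_gInv he i t).mul (contDiffOn_lowGamma he t s k)).congr
      fun q hq => gammaCoeff_eq he hq i s k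
  exact ContDiffOn.sum fun s _ => ContDiffOn.sum fun k _ =>
    ((h s k).mul (contDiff_coord s).contDiffOn).mul (contDiff_coord k).contDiffOn

omit he in
theorem spray_eq (i : Fin n) : F.spray e q.1 q.2 i
    = ∑ k, q.2 k * ∑ j, q.2 j * F.gammaCoeff e q.1 q.2 i j k := by
  simp only [spray, Finset.mul_sum]
  rw [Finset.sum_comm]
  exact Finset.sum_congr rfl fun k _ => Finset.sum_congr rfl fun i _ => by ring

theorem lower_spray (hq : q ∈ slit e) (l : Fin n) :
    ∑ i, F.gFun e l i q * F.spray e q.1 q.2 i = F.lowSpray e l q := by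
  simp only [spray_eq, lowSpray]
  rw [sum_mul_sum_left_comm]
  refine Finset.sum_congr rfl fun k _ => ?_
  rw [sum_mul_sum_left_comm]
  simp only [lower_gammaCoeff he hq]

theorem sum_coord_mul_lowGamma (hq : q ∈ slit e) (l j : Fin n) :
    ∑ k, q.2 k * F.lowGamma e l j k q = 1 / 2 * (∑ k, q.2 k * dX k (F.gFun e l j) q)
      - 1 / 4 * dX l (F.energyDY e j) q + 1 / 4 * dX j (F.energyDY e l) q := by
  have h1 := sum_coord_mul_dX_gFun (F := F) he hq j l
  have h2 := sum_coord_mul_dX_gFun (F := F) he hq l j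
  have : ∀ k, q.2 k * F.lowGamma e l j k q = 1 / 2 * (q.2 k * dX k (F.gFun e l j) q)
      - 1 / 2 * (q.2 k * dX l (F.gFun e j k) q) + 1 / 2 * (q.2 k * dX j (F.gFun e l k) q) := by
    intro k; simp only [lowGamma]; ring
  simp only [this, Finset.sum_add_distrib, Finset.sum_sub_distrib, ← Finset.mul_sum, h1, h2]
  ring

theorem lowGamma_symm (hq : q ∈ slit e) (l j k : Fin n) :
    F.lowGamma e l j k q = F.lowGamma e l k j q := by
  simp only [lowGamma, dX_gFun_symm he hq j k l]; ring

/-- The Euler–Lagrange form of the spray, obtained by applying Euler's relation to the contracted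
Christoffel symbols. It is easier to differentiate along the fibre than the definition. -/
theorem lowSpray_eq (hq : q ∈ slit e) (l : Fin n) :
    F.lowSpray e l q = 1 / 2 * ((∑ k, q.2 k * dX k (F.energyDY e l) q)
      - dX l (F.energy e) q) := by
  have h1 : F.lowSpray e l q = ∑ k, q.2 k * ∑ j, q.2 j * F.lowGamma e l k j q := by
    simp only [lowSpray]
    exact Finset.sum_congr rfl fun k _ => by simp only [lowGamma_symm he hq l k]
  rw [h1]
  simp only [sum_coord_mul_lowGamma he hq, mul_add, mul_sub, Finset.sum_add_distrib,
    Finset.sum_sub_distrib]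
  have h2 : ∑ k, q.2 k * (1 / 2 * ∑ j, q.2 j * dX j (F.gFun e l k) q)
      = 1 / 4 * ∑ k, q.2 k * dX k (F.energyDY e l) q := by
    have := sum_mul_sum_left_comm (fun k => q.2 k) (fun j => q.2 j)
      (fun k j => dX j (F.gFun e l k) q)
    simp only [sum_coord_mul_dX_gFun he hq] at this
    simp only [mul_left_comm _ (1 / 2 : ℝ), ← Finset.mul_sum, this]
    ring
  have h3 := sum_coord_mul_dX_energyDY (F := F) he hq l
  simp only [mul_left_comm _ (1 / 4 : ℝ), ← Finset.mul_sum, h2, h3]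
  ring

/-- Differentiating the Euler–Lagrange form and commuting partial derivatives gives exactly twice
the expression in `sum_coord_mul_lowGamma`. -/
theorem dY_lowSpray (hq : q ∈ slit e) (l j : Fin n) :
    dY j (F.lowSpray e l) q = 2 * ∑ k, q.2 k * F.lowGamma e l j k q := by
  have hE := fun i => contDiffOn_energyDY (F := F) he i
  have hX : ∀ k, ContDiffOn ℝ ∞ (dX k (F.energyDY e l)) (slit e) := fun k =>
    contDiffOn_dirDeriv (hE l) (isOpen_slit e) _
  have hX' : ContDiffOn ℝ ∞ (dX l (F.energy e)) (slit e) :=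
    contDiffOn_dirDeriv (F.contDiffOn_energy he) (isOpen_slit e) _
  have h0 : ContDiffOn ℝ ∞ (fun q => ∑ k, q.2 k * dX k (F.energyDY e l) q) (slit e) :=
    ContDiffOn.sum fun k _ => (contDiff_coord k).contDiffOn.mul (hX k)
  have h1 : dY j (F.lowSpray e l) q = dY j (fun q => 1 / 2 * ((∑ k, q.2 k *
      dX k (F.energyDY e l) q) - dX l (F.energy e) q)) q :=
    dirDeriv_congr (isOpen_slit e) (fun q hq => lowSpray_eq he hq l) hq
  have h2 : dY j (fun q => 1 / 2 * ((∑ k, q.2 k * dX k (F.energyDY e l) q)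
      - dX l (F.energy e) q)) q = 1 / 2 * (dY j (fun q => ∑ k, q.2 k * dX k (F.energyDY e l) q) q
      - dY j (dX l (F.energy e)) q) := by
    refine (dirDeriv_const_mul (differentiableAt_of_slit (h0.sub hX') hq) _).trans ?_
    rw [dirDeriv_sub (differentiableAt_of_slit h0 hq) (differentiableAt_of_slit hX' hq)]
    rfl
  have h3 : dY j (dX l (F.energy e)) q = dX l (F.energyDY e j) q :=
    dirDeriv_comm (F.contDiffOn_energy he) (isOpen_slit e) hq
  have h4 : ∀ k, dY j (dX k (F.energyDY e l)) q = 2 * dX k (F.gFun e l j) q := by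
    intro k
    have h5 : dX k (F.gFun e j l) q = dX k (fun q => 1 / 2 * dY j (F.energyDY e l) q) q :=
      dirDeriv_congr (isOpen_slit e) (fun q hq => gFun_eq he hq j l) hq
    have h6 : ContDiffOn ℝ ∞ (dY j (F.energyDY e l)) (slit e) :=
      contDiffOn_dirDeriv (hE l) (isOpen_slit e) _
    rw [dX_gFun_symm he hq, h5]
    have h7 := dirDeriv_const_mul (w := (EuclideanSpace.single k (1 : ℝ), (0 : Coord n)))
      (differentiableAt_of_slit h6 hq) (1 / 2)
    have h8 : dY j (dX k (F.energyDY e l)) q = dX k (dY j (F.energyDY e l)) q :=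
      dirDeriv_comm (hE l) (isOpen_slit e) hq
    rw [h8]
    simp only [dX]
    rw [h7]
    ring
  rw [h1, h2, dY_sum_coord_mul fun k => differentiableAt_of_slit (hX k) hq, h3,
    sum_coord_mul_lowGamma he hq]
  simp only [h4, mul_left_comm _ (2 : ℝ), ← Finset.mul_sum]
  ring

/-- The non-linear connection with lowered index. -/
theorem lower_nonlin (hq : q ∈ slit e) (l j : Fin n) :
    ∑ i, F.gFun e l i q * F.nonlin e q.1 q.2 i j = (∑ k, q.2 k * F.lowGamma e l j k q)
      - 1 / 2 * ∑ k, F.spray e q.1 q.2 k * F.gDY e l j k q := by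
  have hF : localRep F.toFun e q.1 q.2 ≠ 0 := by
    intro h
    have := energy_pos (F := F) he hq
    simp [energy, h] at this
  -- The factor `F` in the Cartan tensor cancels the division by `F` in `nonlin`.
  have h1 : ∀ i, F.nonlin e q.1 q.2 i j = (∑ k, q.2 k * F.gammaCoeff e q.1 q.2 i j k)
      - ∑ k, (1 / 2 * F.spray e q.1 q.2 k) * ∑ s, (F.g e q.1 q.2)⁻¹ i s * F.gDY e s j k q := by
    intro i
    simp only [nonlin, cartanUp, cartan, pd_gFun_snd he hq]
    congr 1
    · exact Finset.sum_congr rfl fun k _ => mul_comm _ _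
    · refine Finset.sum_congr rfl fun k _ => ?_
      simp only [← spray.eq_1]
      rw [div_eq_iff hF, Finset.sum_mul, Finset.mul_sum, Finset.sum_mul]
      exact Finset.sum_congr rfl fun s _ => by ring
  simp only [h1, mul_sub, Finset.sum_sub_distrib]
  congr 1
  · rw [sum_mul_sum_left_comm]
    exact Finset.sum_congr rfl fun k _ => by rw [lower_gammaCoeff he hq]
  · rw [sum_mul_sum_left_comm, Finset.mul_sum]
    refine Finset.sum_congr rfl fun k _ => ?_
    rw [lower_raise he hq (fun s => F.gDY e s j k q)]
    ring

theorem cartanNonlin_eq_dY (hq : q ∈ slit e) (i j : Fin n) : F.cartanNonlin e q.1 q.2 i j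
    = 1 / 2 * dY j (fun q : Coord n × Coord n => F.spray e q.1 q.2 i) q := by
  simp only [cartanNonlin]
  rw [pd_snd_eq_dY (f := fun q : Coord n × Coord n => F.spray e q.1 q.2 i)
    (differentiableAt_of_slit (contDiffOn_spray he i) hq)]

/-- The two expressions of the non-linear connection agree. -/
theorem cartanNonlin_eq_nonlin (hq : q ∈ slit e) (i j : Fin n) :
    F.cartanNonlin e q.1 q.2 i j = F.nonlin e q.1 q.2 i j := by
  refine eq_of_lower_eq (F := F) he hq (v := fun i => F.cartanNonlin e q.1 q.2 i j)
    (w := fun i => F.nonlin e q.1 q.2 i j) (fun l => ?_) i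
  rw [lower_nonlin he hq]
  -- The relation `g_li Gⁱ = G_l` is differentiated in `yʲ`. By total symmetry, the term in which
  -- `g` is differentiated is the Cartan term of `lower_nonlin`.
  have h1 : dY j (fun q : Coord n × Coord n => ∑ i, F.gFun e l i q * F.spray e q.1 q.2 i) q
      = dY j (F.lowSpray e l) q :=
    dirDeriv_congr (isOpen_slit e) (fun q hq => lower_spray he hq l) hq
  rw [dY_lowSpray he hq] at h1
  have h2 := dirDeriv_sum_mul (w := (0, EuclideanSpace.single j (1 : ℝ)))
    (fun i => differentiableAt_of_slit (contDiffOn_gFun (F := F) he l i) hq)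
    (fun i => differentiableAt_of_slit (contDiffOn_spray (F := F) he i) hq)
  rw [Finset.sum_add_distrib] at h2
  have h3 : ∀ i, dirDeriv (0, EuclideanSpace.single j (1 : ℝ)) (F.gFun e l i) q
      * F.spray e q.1 q.2 i = F.spray e q.1 q.2 i * F.gDY e l j i q := by
    intro i
    have h4 : F.gDY e l i j q = F.gDY e l j i q := by
      rw [gDY_swap_left he hq l i, gDY_swap_right he hq i, gDY_swap_left he hq j l]
    rw [← h4, mul_comm]
    rfl
  simp only [h3] at h2
  simp only [cartanNonlin_eq_dY he hq, mul_left_comm _ (1 / 2 : ℝ), ← Finset.mul_sum]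
  have h5 : ∑ i, F.gFun e l i q * dY j (fun q : Coord n × Coord n => F.spray e q.1 q.2 i) q
      = 2 * ∑ k, q.2 k * F.lowGamma e l j k q
        - ∑ k, F.spray e q.1 q.2 k * F.gDY e l j k q := by
    rw [← h1]
    simp only [dY]
    rw [h2]
    ring
  rw [h5]
  ring

/-- The Cartan part of `N` is annihilated by `y`, and what remains is `γⁱ_jk yʲ yᵏ`. -/
theorem sum_coord_mul_nonlin (hq : q ∈ slit e) (i : Fin n) :
    ∑ j, q.2 j * F.nonlin e q.1 q.2 i j = F.spray e q.1 q.2 i := by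
  refine eq_of_lower_eq (F := F) he hq (v := fun i => ∑ j, q.2 j * F.nonlin e q.1 q.2 i j)
    (w := fun i => F.spray e q.1 q.2 i) (fun l => ?_) i
  simp only
  rw [sum_mul_sum_left_comm, lower_spray he hq]
  simp only [lower_nonlin he hq, mul_sub, Finset.sum_sub_distrib]
  have h1 : ∑ j, q.2 j * (1 / 2 * ∑ k, F.spray e q.1 q.2 k * F.gDY e l j k q) = 0 := by
    simp only [mul_left_comm _ (1 / 2 : ℝ), ← Finset.mul_sum]
    rw [sum_mul_sum_left_comm]
    simp [sum_coord_mul_gDY_middle he hq]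
  rw [h1, sub_zero]
  simp only [lowSpray]
  exact Finset.sum_congr rfl fun k _ => by simp only [lowGamma_symm he hq l k]

/-- The horizontal derivative of `F²` vanishes. -/
theorem dX_energy_eq (hq : q ∈ slit e) (k : Fin n) :
    dX k (F.energy e) q = ∑ m, F.nonlin e q.1 q.2 m k * F.energyDY e m q := by
  -- In this form `∂F²/∂yᵐ` lowers the index of `N`, so `lower_nonlin` applies and its Cartan term
  -- is contracted with `y`.
  have h1 : ∀ m, F.energyDY e m q = 2 * ∑ l, q.2 l * F.gFun e l m q := fun m => by
    rw [sum_coord_mul_gFun_left he hq]; ring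
  simp only [h1, mul_left_comm _ (2 : ℝ), ← Finset.mul_sum]
  rw [sum_mul_sum_left_comm]
  have h2 : ∀ l, ∑ m, F.nonlin e q.1 q.2 m k * F.gFun e l m q
      = ∑ m, F.gFun e l m q * F.nonlin e q.1 q.2 m k := fun l =>
    Finset.sum_congr rfl fun m _ => mul_comm _ _
  simp only [h2, lower_nonlin he hq, mul_sub, Finset.sum_sub_distrib]
  have h3 : ∑ j, q.2 j * (1 / 2 * ∑ s, F.spray e q.1 q.2 s * F.gDY e j k s q) = 0 := by
    simp only [mul_left_comm _ (1 / 2 : ℝ), ← Finset.mul_sum]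
    rw [sum_mul_sum_left_comm]
    simp [sum_coord_mul_gDY_left he hq]
  rw [h3, mul_zero, sub_zero]
  simp only [sum_coord_mul_lowGamma he hq, mul_sub, mul_add, Finset.sum_sub_distrib,
    Finset.sum_add_distrib, mul_left_comm _ (1 / 4 : ℝ), mul_left_comm _ (1 / 2 : ℝ),
    ← Finset.mul_sum]
  rw [sum_coord_mul_dX_energyDY he hq, sum_mul_sum_left_comm]
  have h4 : ∀ l, ∑ i, q.2 i * dX l (F.gFun e i k) q = 1 / 2 * dX l (F.energyDY e k) q := by
    intro l
    rw [← sum_coord_mul_dX_gFun he hq]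
    exact Finset.sum_congr rfl fun i _ => by rw [dX_gFun_symm he hq]
  simp only [h4, mul_left_comm _ (1 / 2 : ℝ), ← Finset.mul_sum]
  ring

theorem deltaG_eq (hq : q ∈ slit e) (k i j : Fin n) : F.deltaG e q.1 q.2 k i j
    = dX k (F.gFun e i j) q - ∑ m, F.nonlin e q.1 q.2 m k * F.gDY e i j m q := by
  simp only [deltaG, pd_gFun_fst he hq, pd_gFun_snd he hq]

theorem lower_chernCoeff (hq : q ∈ slit e) (l j k : Fin n) :
    ∑ i, F.gFun e l i q * F.chernCoeff e q.1 q.2 i j k = 1 / 2 * (F.deltaG e q.1 q.2 k l j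
      - F.deltaG e q.1 q.2 l j k + F.deltaG e q.1 q.2 j l k) := by
  rw [← lower_raise he hq (fun s => 1 / 2 * (F.deltaG e q.1 q.2 k s j - F.deltaG e q.1 q.2 s j k
    + F.deltaG e q.1 q.2 j s k)) l]
  refine Finset.sum_congr rfl fun i _ => ?_
  simp only [chernCoeff, Finset.mul_sum]
  refine Finset.sum_congr rfl fun s _ => ?_
  ring

/-- Contracting the Chern coefficients with `y` gives the non-linear connection. -/
theorem sum_coord_mul_chernCoeff (hq : q ∈ slit e) (i j : Fin n) :
    ∑ k, q.2 k * F.chernCoeff e q.1 q.2 i j k = F.nonlin e q.1 q.2 i j := by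
  refine eq_of_lower_eq (F := F) he hq (v := fun i => ∑ k, q.2 k * F.chernCoeff e q.1 q.2 i j k)
    (w := fun i => F.nonlin e q.1 q.2 i j) (fun l => ?_) i
  simp only
  rw [sum_mul_sum_left_comm, lower_nonlin he hq]
  -- Of the three vertical terms, two contract `y` with an index of `∂g/∂y` and vanish. In the
  -- third, `y` is contracted with `N` and yields the spray (`h1`), which reproduces the Cartan term
  -- of `N`.
  have h0 : ∀ a c, ∑ k, q.2 k * ∑ m, F.nonlin e q.1 q.2 m c * F.gDY e a k m q = 0 := by
    intro a c
    rw [sum_mul_sum_left_comm]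
    simp [sum_coord_mul_gDY_middle he hq]
  have h1 : ∑ k, q.2 k * ∑ m, F.nonlin e q.1 q.2 m k * F.gDY e l j m q
      = ∑ m, F.spray e q.1 q.2 m * F.gDY e l j m q := by
    simp only [← sum_coord_mul_nonlin he hq]
    simp only [Finset.mul_sum, Finset.sum_mul]
    rw [Finset.sum_comm]
    exact Finset.sum_congr rfl fun k _ => Finset.sum_congr rfl fun i _ => by ring
  simp only [lower_chernCoeff he hq, deltaG_eq he hq, mul_left_comm _ (1 / 2 : ℝ),
    ← Finset.mul_sum, mul_add, mul_sub, Finset.sum_add_distrib, Finset.sum_sub_distrib, h0, h1,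
    sum_coord_mul_lowGamma he hq, sum_coord_mul_dX_gFun he hq]
  ring

end Identities

end FinslerStructure
end Finsler

/-! ### Structures whose spray is quadratic or whose non-linear connection is linear. -/

namespace Finsler

theorem pd_sum_mul_coord {n : ℕ} (a : Fin n → ℝ) (k : Fin n) (y : Coord n) :
    pd k (fun y' => ∑ l, a l * y' l) y = a k := by
  have h : HasFDerivAt (fun y' : Coord n => ∑ l, a l * y' l)
      (∑ l, a l • (EuclideanSpace.proj l : Coord n →L[ℝ] ℝ)) y :=
    HasFDerivAt.fun_sum fun l _ =>
      ((EuclideanSpace.proj l : Coord n →L[ℝ] ℝ).hasFDerivAt).const_mul (a l)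
  simp [pd, h.fderiv, sum_apply]

namespace FinslerStructure

variable {n : ℕ} {M : Type*} [TopologicalSpace M] [ChartedSpace (Coord n) M]
  [IsManifold (𝓡 n) ∞ M] {F : FinslerStructure n M}
  {e : OpenPartialHomeomorph M (Coord n)} {x y : Coord n}
  (he : e ∈ IsManifold.maximalAtlas (𝓡 n) ∞ M)

include he

/-- If the Chern coefficients at `x` do not depend on `y`, then they are the coefficients of the
linear Berwald connection. -/
theorem berwaldCoeff_eq_of_chernCoeff_eq (hx : x ∈ e.target) {Γ : Fin n → Fin n → Fin n → ℝ}
    (h : ∀ y, y ≠ 0 → F.chernCoeff e x y = Γ) (hy : y ≠ 0) : F.berwaldCoeff e x y = Γ := by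
  funext i j k
  have h1 : EqOn (fun y' => F.cartanNonlin e x y' i j) (fun y' => ∑ l, Γ i j l * y' l)
      {y | y ≠ 0} := by
    intro y' hy'
    have hq : (x, y') ∈ slit e := ⟨hx, hy'⟩
    have h2 := sum_coord_mul_chernCoeff (F := F) he hq i j
    simp only [h y' hy'] at h2
    simp only
    rw [cartanNonlin_eq_nonlin (q := (x, y')) he hq, ← h2]
    exact Finset.sum_congr rfl fun l _ => mul_comm _ _
  simp only [berwaldCoeff]
  rw [pd_congr isOpen_ne h1 hy, pd_sum_mul_coord]

theorem nonlin_eq_of_chernCoeff_eq (hx : x ∈ e.target) {Γ : Fin n → Fin n → Fin n → ℝ}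
    (h : ∀ y, y ≠ 0 → F.chernCoeff e x y = Γ) (hy : y ≠ 0) (i j : Fin n) :
    F.nonlin e x y i j = ∑ k, y k * Γ i j k := by
  rw [← sum_coord_mul_chernCoeff (F := F) (q := (x, y)) he ⟨hx, hy⟩ i j, h y hy]

/-- The linear Berwald connection has the geodesic spray of the Finsler structure. -/
theorem sum_berwaldCoeff (hx : x ∈ e.target) (hy : y ≠ 0) (i : Fin n) :
    ∑ j, ∑ k, F.berwaldCoeff e x y i j k * y j * y k = F.spray e x y i := by
  have hq : (x, y) ∈ slit e := ⟨hx, hy⟩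
  let N : Fin n → Coord n × Coord n → ℝ := fun j =>
    dY j (fun q : Coord n × Coord n => F.spray e q.1 q.2 i)
  have hN : ∀ j, ContDiffOn ℝ ∞ (N j) (slit e) := fun j =>
    contDiffOn_dirDeriv (contDiffOn_spray he i) (isOpen_slit e) _
  -- Euler's relation for the spray, here a consequence of `yʲ Nⁱ_j = Gⁱ`. Differentiating it gives
  -- the corresponding relation `h2` for its first derivatives.
  have h1 : ∀ q ∈ slit e, ∑ j, q.2 j * N j q = 2 * F.spray e q.1 q.2 i := by
    intro q hq
    rw [← sum_coord_mul_nonlin he hq, Finset.mul_sum]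
    refine Finset.sum_congr rfl fun j _ => ?_
    rw [← cartanNonlin_eq_nonlin he hq, cartanNonlin_eq_dY he hq]
    simp only [N]
    ring
  have h2 : ∀ k, ∑ j, y j * dY k (N j) (x, y) = N k (x, y) := by
    intro k
    have h3 : dY k (fun q => ∑ j, q.2 j * N j q) (x, y)
        = dY k (fun q : Coord n × Coord n => 2 * F.spray e q.1 q.2 i) (x, y) :=
      dirDeriv_congr (isOpen_slit e) h1 hq
    rw [dY_sum_coord_mul fun j => differentiableAt_of_slit (hN j) hq] at h3
    have h4 := dirDeriv_const_mul (w := (0, EuclideanSpace.single k (1 : ℝ)))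
      (differentiableAt_of_slit (contDiffOn_spray (F := F) he i) hq) 2
    have h5 := h3.trans h4
    change _ = 2 * N k (x, y) at h5
    linarith
  have h6 : ∀ j k, F.berwaldCoeff e x y i j k = 1 / 2 * dY k (N j) (x, y) := by
    intro j k
    have h7 : EqOn (fun y' => F.cartanNonlin e x y' i j) (fun y' => 1 / 2 * N j (x, y'))
        {y | y ≠ 0} := fun y' hy' => cartanNonlin_eq_dY (q := (x, y')) he ⟨hx, hy'⟩ i j
    have h8 : DifferentiableAt ℝ (N j) (x, y) := differentiableAt_of_slit (hN j) hq
    simp only [berwaldCoeff]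
    rw [pd_congr isOpen_ne h7 hy, pd_snd_eq_dY (f := fun q => 1 / 2 * N j q) (h8.const_mul _)]
    exact dirDeriv_const_mul h8 _
  have h9 := h1 (x, y) hq
  simp only [← h2] at h9
  rw [Finset.sum_comm]
  have h10 : F.spray e x y i = 1 / 2 * ∑ j, y j * ∑ k, y k * dY j (N k) (x, y) := by
    rw [h9]; ring
  rw [h10, Finset.mul_sum]
  refine Finset.sum_congr rfl fun k _ => ?_
  rw [Finset.mul_sum, Finset.mul_sum]
  refine Finset.sum_congr rfl fun j _ => ?_
  rw [h6]
  ring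

/-- The horizontal derivative of `∂F²/∂yⁱ` when the non-linear connection is linear at `x`. -/
theorem dX_energyDY_eq (hx : x ∈ e.target) {Γ : Fin n → Fin n → Fin n → ℝ}
    (h : ∀ y, y ≠ 0 → ∀ i j, F.nonlin e x y i j = ∑ k, y k * Γ i j k) (hy : y ≠ 0)
    (k i : Fin n) : dX k (F.energyDY e i) (x, y) = ∑ m, (Γ m k i * F.energyDY e m (x, y)
      + (∑ l, y l * Γ m k l) * dY i (F.energyDY e m) (x, y)) := by
  have hq : (x, y) ∈ slit e := ⟨hx, hy⟩
  have hE := fun m => contDiffOn_energyDY (F := F) he m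
  have h1 : dX k (F.energyDY e i) (x, y) = dY i (dX k (F.energy e)) (x, y) :=
    dirDeriv_comm (F.contDiffOn_energy he) (isOpen_slit e) hq
  have hc : ∀ m, DifferentiableAt ℝ (fun q : Coord n × Coord n => ∑ l, q.2 l * Γ m k l) (x, y) :=
    fun m => by fun_prop
  have hE' : ∀ m, DifferentiableAt ℝ (F.energyDY e m) (x, y) := fun m =>
    differentiableAt_of_slit (hE m) hq
  -- The linear form of `N` is available only over this `x`, but on the whole slit fibre; that
  -- suffices for differentiating in `y`.
  have h2 : dY i (dX k (F.energy e)) (x, y)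
      = dY i (fun q => ∑ m, (∑ l, q.2 l * Γ m k l) * F.energyDY e m q) (x, y) := by
    refine dY_congr_fiber (differentiableAt_of_slit
      (contDiffOn_dirDeriv (F.contDiffOn_energy he) (isOpen_slit e) _) hq)
      (DifferentiableAt.fun_sum fun m _ => (hc m).mul (hE' m)) (fun y' hy' => ?_) hy i
    refine (dX_energy_eq (q := (x, y')) he ⟨hx, hy'⟩ k).trans ?_
    simp only [h y' hy']
    rfl
  rw [h1, h2]
  simp only [dY]
  rw [dirDeriv_sum_mul hc hE']
  refine Finset.sum_congr rfl fun m _ => ?_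
  rw [dirDeriv_sum_coord_mul fun l => differentiableAt_const _]
  simp [dirDeriv]

/-- The second fibre derivative of `δF²/δxᵏ = 0`. Moving the last term to the left turns it into
compatibility of `Γ` with `g`. -/
theorem dX_gFun_eq (hx : x ∈ e.target) {Γ : Fin n → Fin n → Fin n → ℝ}
    (h : ∀ y, y ≠ 0 → ∀ i j, F.nonlin e x y i j = ∑ k, y k * Γ i j k) (hy : y ≠ 0)
    (k i j : Fin n) : dX k (F.gFun e i j) (x, y) = ∑ m, (Γ m k i * F.gFun e j m (x, y)
      + Γ m k j * F.gFun e i m (x, y) + (∑ l, y l * Γ m k l) * F.gDY e i j m (x, y)) := by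
  have hq : (x, y) ∈ slit e := ⟨hx, hy⟩
  have hE := fun m => contDiffOn_energyDY (F := F) he m
  have hE' : ∀ m, DifferentiableAt ℝ (F.energyDY e m) (x, y) := fun m =>
    differentiableAt_of_slit (hE m) hq
  have hd : ∀ w m, ContDiffOn ℝ ∞ (dirDeriv w (F.energyDY e m)) (slit e) := fun w m =>
    contDiffOn_dirDeriv (hE m) (isOpen_slit e) w
  have hc : ∀ m, DifferentiableAt ℝ (fun q : Coord n × Coord n => ∑ l, q.2 l * Γ m k l) (x, y) :=
    fun m => by fun_prop
  have h0 : dX k (F.gFun e i j) (x, y) = 1 / 2 * dY j (dX k (F.energyDY e i)) (x, y) := by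
    have h1 : dX k (F.gFun e j i) (x, y) = dX k (fun q => 1 / 2 * dY j (F.energyDY e i) q) (x, y) :=
      dirDeriv_congr (isOpen_slit e) (fun q hq => gFun_eq he hq j i) hq
    rw [dX_gFun_symm he hq, h1]
    refine (dirDeriv_const_mul (differentiableAt_of_slit (hd _ i) hq) _).trans ?_
    congr 1
    exact dirDeriv_comm (hE i) (isOpen_slit e) hq
  -- Summing over `Fin n ⊕ Fin n` puts both kinds of products into one sum, so that
  -- `dirDeriv_sum_mul` applies once.
  have h2 : dY j (dX k (F.energyDY e i)) (x, y) = dY j (fun q => ∑ s : Fin n ⊕ Fin n,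
      Sum.elim (fun m _ => Γ m k i) (fun m q => ∑ l, q.2 l * Γ m k l) s q
      * Sum.elim (fun m => F.energyDY e m) (fun m => dY i (F.energyDY e m)) s q) (x, y) := by
    refine dY_congr_fiber (differentiableAt_of_slit (hd _ i) hq)
      (DifferentiableAt.fun_sum fun s _ => ?_) (fun y' hy' => ?_) hy j
    · rcases s with m | m
      · exact (differentiableAt_const _).mul (hE' m)
      · exact (hc m).mul (differentiableAt_of_slit (hd _ m) hq)
    · refine (dX_energyDY_eq he hx h hy' k i).trans ?_
      rw [Fintype.sum_sum_type, Finset.sum_add_distrib]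
      rfl
  rw [h0, h2]
  simp only [dY]
  rw [dirDeriv_sum_mul]
  · rw [Fintype.sum_sum_type, ← Finset.sum_add_distrib, Finset.mul_sum]
    refine Finset.sum_congr rfl fun m _ => ?_
    simp only [Sum.elim_inl, Sum.elim_inr]
    rw [dirDeriv_sum_coord_mul fun l => differentiableAt_const _]
    have h3 : F.gFun e j m (x, y) = 1 / 2 * dirDeriv (0, EuclideanSpace.single j 1)
        (F.energyDY e m) (x, y) := gFun_eq he hq j m
    have h4 : F.gFun e i m (x, y) = 1 / 2 * dirDeriv (0, EuclideanSpace.single i 1)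
        (F.energyDY e m) (x, y) := gFun_eq he hq i m
    have h5 : F.gDY e i j m (x, y) = 1 / 2 * dirDeriv (0, EuclideanSpace.single j 1)
        (dirDeriv (0, EuclideanSpace.single i 1) (F.energyDY e m)) (x, y) := by
      rw [gDY_swap_left he hq i j, gDY_swap_right he hq j i, gDY_swap_left he hq m i,
        gDY_eq he hq]
      rfl
    simp only [h3, h4, h5]
    simp [dirDeriv]
    ring
  · rintro (m | m)
    · exact differentiableAt_const _
    · exact hc m
  · rintro (m | m)
    · exact hE' m
    · exact differentiableAt_of_slit (hd _ m) hq

/-- If the spray at `x` is quadratic, then its coefficients are those of the Chern connection. -/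
theorem chernCoeff_eq_of_spray_eq (hx : x ∈ e.target) {Γ : Fin n → Fin n → Fin n → ℝ}
    (hΓ : ∀ i j k, Γ i j k = Γ i k j)
    (h : ∀ y, y ≠ 0 → ∀ i, F.spray e x y i = ∑ j, ∑ k, Γ i j k * y j * y k) (hy : y ≠ 0) :
    F.chernCoeff e x y = Γ := by
  have hN : ∀ y, y ≠ 0 → ∀ i j, F.nonlin e x y i j = ∑ k, y k * Γ i j k := by
    intro y hy i j
    have hq : (x, y) ∈ slit e := ⟨hx, hy⟩
    have h1 := cartanNonlin_eq_nonlin (F := F) he hq i j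
    simp only at h1
    have h2 : EqOn (fun y' => F.spray e x y' i)
      (fun y' => (fun q : Coord n × Coord n => ∑ k, q.2 k * ∑ l, q.2 l * Γ i k l) (x, y'))
        {y | y ≠ 0} := by
      intro y' hy'
      simp only
      rw [h y' hy']
      simp only [Finset.mul_sum]
      exact Finset.sum_congr rfl fun _ _ => Finset.sum_congr rfl fun _ _ => by ring
    have h3 : ∀ m, DifferentiableAt ℝ (fun q : Coord n × Coord n => ∑ l, q.2 l * Γ i m l) (x, y) :=
      fun m => by fun_prop
    rw [← h1, cartanNonlin, pd_congr isOpen_ne h2 hy, pd_snd_eq_dY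
      (f := fun q : Coord n × Coord n => ∑ k, q.2 k * ∑ l, q.2 l * Γ i k l), dY_sum_coord_mul h3]
    · have h4 : ∀ m, dY j (fun q : Coord n × Coord n => ∑ l, q.2 l * Γ i m l) (x, y) = Γ i m j := by
        intro m
        rw [dY_sum_coord_mul fun l => differentiableAt_const _]
        simp [dY, dirDeriv]
      simp only [h4, hΓ i _ j]
      ring
    · exact DifferentiableAt.fun_sum fun m _ => ((contDiff_coord m).differentiable
        (by simp) _).mul (h3 m)
  symm
  rw [← chernCoeff_unique he hx hy]
  refine ⟨hΓ, fun i j k => ?_⟩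
  have hq : (x, y) ∈ slit e := ⟨hx, hy⟩
  -- The vertical term of `deltaG` cancels the last term of `dX_gFun_eq`, leaving the compatibility
  -- equation.
  rw [deltaG_eq (q := (x, y)) he hq, dX_gFun_eq he hx hN hy]
  simp only [hN y hy]
  rw [← Finset.sum_sub_distrib]
  refine Finset.sum_congr rfl fun m _ => ?_
  have h1 : F.g e x y m j = F.gFun e j m (x, y) := g_symm he hx hy m j
  have h2 : F.g e x y i m = F.gFun e i m (x, y) := rfl
  rw [h1, h2, hΓ m i k, hΓ m j k]
  ring

end FinslerStructure
end Finsler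

/-! ### The Levi-Civita connection in charts and its transformation law. -/

namespace Finsler

section Transition

variable {n : ℕ} {M : Type*} [TopologicalSpace M] [ChartedSpace (Coord n) M]
  [IsManifold (𝓡 n) ∞ M] {e e' : OpenPartialHomeomorph M (Coord n)} {x : Coord n}

theorem frame_surjective (he : e ∈ IsManifold.maximalAtlas (𝓡 n) ∞ M) (hx : x ∈ e.target) :
    Function.Surjective (frame e x) :=
  (LinearMap.injective_iff_surjective (f := (frame e x).toLinearMap)).1 (frame_injective he hx)

theorem fderiv_transition_surjective (he : e ∈ IsManifold.maximalAtlas (𝓡 n) ∞ M)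
    (he' : e' ∈ IsManifold.maximalAtlas (𝓡 n) ∞ M) (hx : x ∈ e.target)
    (hx' : e.symm x ∈ e'.source) : Function.Surjective (fderiv ℝ (transition e e') x) := by
  intro w
  obtain ⟨v, hv⟩ := frame_surjective he hx (frame e' (transition e e' x) w)
  exact ⟨v, frame_injective he' (e'.map_source hx')
    ((frame_transition he he' hx hx' v).trans hv)⟩

theorem fderiv_transition_ne_zero (he : e ∈ IsManifold.maximalAtlas (𝓡 n) ∞ M)
    (he' : e' ∈ IsManifold.maximalAtlas (𝓡 n) ∞ M) (hx : x ∈ e.target)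
    (hx' : e.symm x ∈ e'.source) {u : Coord n} (hu : u ≠ 0) :
    fderiv ℝ (transition e e') x u ≠ 0 := by
  intro h
  have := frame_transition he he' hx hx' u
  rw [h, map_zero] at this
  exact frame_ne_zero he hx hu this.symm

end Transition

namespace RiemMetric

variable {n : ℕ} {M : Type*} [TopologicalSpace M] [ChartedSpace (Coord n) M]
  [IsManifold (𝓡 n) ∞ M] (h : RiemMetric n M)
  {e e' : OpenPartialHomeomorph M (Coord n)} {x : Coord n}

theorem pullForm_eq_sum_comp (e : OpenPartialHomeomorph M (Coord n)) (x u v : Coord n) :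
    pullForm h.inner e x u v = ∑ i, ∑ j, comp h e x i j * (u i * v j) :=
  pullForm_eq_sum h.inner e x u v

theorem pullForm_symm (e : OpenPartialHomeomorph M (Coord n)) (x u v : Coord n) :
    pullForm h.inner e x u v = pullForm h.inner e x v u := h.symm _ _ _

theorem comp_symm (e : OpenPartialHomeomorph M (Coord n)) (x : Coord n) (i j : Fin n) :
    comp h e x i j = comp h e x j i := pullForm_symm h e x _ _

theorem contDiffOn_comp (he : e ∈ IsManifold.maximalAtlas (𝓡 n) ∞ M) (i j : Fin n) :
    ContDiffOn ℝ ∞ (fun x => comp h e x i j) e.target :=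
  h.contDiffOn_pullForm he _ _

theorem pullForm_pos (he : e ∈ IsManifold.maximalAtlas (𝓡 n) ∞ M) (hx : x ∈ e.target)
    {u : Coord n} (hu : u ≠ 0) : 0 < pullForm h.inner e x u u :=
  h.pos _ _ (frame_ne_zero he hx hu)

theorem det_comp_ne_zero (he : e ∈ IsManifold.maximalAtlas (𝓡 n) ∞ M) (hx : x ∈ e.target) :
    (comp h e x).det ≠ 0 := by
  intro hdet
  obtain ⟨v, hv, hv'⟩ := Matrix.exists_mulVec_eq_zero_iff.2 hdet
  have h1 := pullForm_pos h he hx (u := WithLp.toLp 2 v)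
    (fun h => hv (by simpa using h))
  rw [pullForm_eq_sum_comp] at h1
  have h2 : ∀ i, ∑ j, comp h e x i j * v j = 0 := fun i => congrFun hv' i
  have h3 : ∑ i, ∑ j, comp h e x i j * (v i * v j) = ∑ i, v i * ∑ j, comp h e x i j * v j := by
    simp only [Finset.mul_sum]
    exact Finset.sum_congr rfl fun _ _ => Finset.sum_congr rfl fun _ _ => by ring
  simp only at h1
  rw [h3] at h1
  simp [h2] at h1

theorem sum_comp_mul_inv (he : e ∈ IsManifold.maximalAtlas (𝓡 n) ∞ M) (hx : x ∈ e.target)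
    (v : Fin n → ℝ) (l : Fin n) :
    ∑ i, comp h e x l i * ∑ s, (comp h e x)⁻¹ i s * v s = v l := by
  have := congrFun (Matrix.mulVec_mulVec v (comp h e x) (comp h e x)⁻¹) l
  rw [Matrix.mul_nonsing_inv _ (det_comp_ne_zero h he hx).isUnit, Matrix.one_mulVec] at this
  simpa [Matrix.mulVec, dotProduct] using this

theorem sum_inv_mul_comp (he : e ∈ IsManifold.maximalAtlas (𝓡 n) ∞ M) (hx : x ∈ e.target)
    (v : Fin n → ℝ) (l : Fin n) :
    ∑ i, (comp h e x)⁻¹ l i * ∑ s, comp h e x i s * v s = v l := by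
  have := congrFun (Matrix.mulVec_mulVec v (comp h e x)⁻¹ (comp h e x)) l
  rw [Matrix.nonsing_inv_mul _ (det_comp_ne_zero h he hx).isUnit, Matrix.one_mulVec] at this
  simpa [Matrix.mulVec, dotProduct] using this

theorem pd_comp_symm (e : OpenPartialHomeomorph M (Coord n)) (x : Coord n) (i j k : Fin n) :
    pd k (fun x' => comp h e x' i j) x = pd k (fun x' => comp h e x' j i) x := by
  simp only [comp_symm h e _ i j]

theorem leviCivitaCoeff_symm (e : OpenPartialHomeomorph M (Coord n)) (x y : Coord n)
    (i j k : Fin n) : h.leviCivitaCoeff e x y i j k = h.leviCivitaCoeff e x y i k j := by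
  simp only [leviCivitaCoeff]
  congr 1
  refine Finset.sum_congr rfl fun s _ => ?_
  rw [pd_comp_symm h e x j k s]
  ring

/-- A torsion-free metric connection is the Levi-Civita connection. -/
theorem leviCivitaCoeff_eq_of_metric (he : e ∈ IsManifold.maximalAtlas (𝓡 n) ∞ M)
    (hx : x ∈ e.target) {Γ : Fin n → Fin n → Fin n → ℝ} (hΓ : ∀ i j k, Γ i j k = Γ i k j)
    (hm : ∀ i j k, pd k (fun x' => comp h e x' i j) x
      = ∑ l, (comp h e x l j * Γ l i k + comp h e x i l * Γ l j k)) (y : Coord n) :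
    h.leviCivitaCoeff e x y = Γ := by
  funext i j k
  have h1 : ∀ s, pd k (fun x' => comp h e x' s j) x - pd s (fun x' => comp h e x' j k) x
      + pd j (fun x' => comp h e x' s k) x = 2 * ∑ l, comp h e x s l * Γ l j k := by
    intro s
    rw [hm, hm, hm, ← Finset.sum_sub_distrib, ← Finset.sum_add_distrib, Finset.mul_sum]
    refine Finset.sum_congr rfl fun l _ => ?_
    rw [comp_symm h e x j l, hΓ l k j, hΓ l j s, hΓ l k s]
    ring
  simp only [leviCivitaCoeff, h1]
  rw [← sum_inv_mul_comp h he hx (fun l => Γ l j k) i, Finset.mul_sum]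
  exact Finset.sum_congr rfl fun l _ => by ring

/-- The vector `Γⁱ_jk(x) uʲ uᵏ` of the Levi-Civita connection. -/
def geodesicVec (e : OpenPartialHomeomorph M (Coord n)) (x u : Coord n) : Coord n :=
  WithLp.toLp 2 fun i => ∑ j, ∑ k, h.leviCivitaCoeff e x u i j k * u j * u k

theorem hasDerivAt_pullForm (he : e ∈ IsManifold.maximalAtlas (𝓡 n) ∞ M) {z u v : ℝ → Coord n}
    {z' u' v' : Coord n} {t : ℝ} (hz : HasDerivAt z z' t) (hu : HasDerivAt u u' t)
    (hv : HasDerivAt v v' t) (hzt : z t ∈ e.target) :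
    HasDerivAt (fun s => pullForm h.inner e (z s) (u s) (v s))
      ((∑ i, ∑ j, fderiv ℝ (fun x => comp h e x i j) (z t) z' * (u t i * v t j))
        + pullForm h.inner e (z t) u' (v t) + pullForm h.inner e (z t) (u t) v') t := by
  have hc : ∀ (w : ℝ → Coord n) w' (_ : HasDerivAt w w' t) (i : Fin n),
      HasDerivAt (fun s => w s i) (w' i) t := fun w w' hw i =>
    (EuclideanSpace.proj i : Coord n →L[ℝ] ℝ).hasFDerivAt.comp_hasDerivAt t hw
  have h1 : ∀ i j, HasDerivAt (fun s => comp h e (z s) i j * (u s i * v s j))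
      (fderiv ℝ (fun x => comp h e x i j) (z t) z' * (u t i * v t j)
        + comp h e (z t) i j * (u' i * v t j + u t i * v' j)) t := by
    intro i j
    have h2 : DifferentiableAt ℝ (fun x => comp h e x i j) (z t) :=
      ((contDiffOn_comp h he i j).contDiffAt (e.open_target.mem_nhds hzt)).differentiableAt
        (by simp)
    exact (h2.hasFDerivAt.comp_hasDerivAt t hz).mul ((hc u u' hu i).mul (hc v v' hv j))
  simp only [pullForm_eq_sum_comp]
  refine (HasDerivAt.fun_sum fun i _ => HasDerivAt.fun_sum fun j _ => h1 i j).congr_deriv ?_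
  simp only [← Finset.sum_add_distrib]
  exact Finset.sum_congr rfl fun _ _ => Finset.sum_congr rfl fun _ _ => by ring

variable (e x) in
/-- The derivative of the metric in the direction `w`, evaluated at `u` and `v`. -/
def compDeriv (w u v : Coord n) : ℝ :=
  ∑ i, ∑ j, fderiv ℝ (fun x => comp h e x i j) x w * (u i * v j)

theorem fderiv_eq_sum_pd (f : Coord n → ℝ) (w : Coord n) :
    fderiv ℝ f x w = ∑ k, w k * pd k f x := by
  have hs : w = ∑ i, w i • EuclideanSpace.single i (1 : ℝ) := by
    simpa using ((EuclideanSpace.basisFun (Fin n) ℝ).sum_repr w).symm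
  conv_lhs => rw [hs]
  simp only [map_sum, map_smul, smul_eq_mul, pd]

theorem comp_geodesicVec (he : e ∈ IsManifold.maximalAtlas (𝓡 n) ∞ M) (hx : x ∈ e.target)
    (u : Coord n) (l : Fin n) : ∑ i, comp h e x l i * geodesicVec h e x u i
      = ∑ j, ∑ k, u j * u k * (pd k (fun x' => comp h e x' l j) x
        - 1 / 2 * pd l (fun x' => comp h e x' j k) x) := by
  have h2 : ∀ i, geodesicVec h e x u i = ∑ s, (comp h e x)⁻¹ i s * (∑ j, ∑ k, 1 / 2 * (u j * u k
      * (pd k (fun x' => comp h e x' s j) x - pd s (fun x' => comp h e x' j k) x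
        + pd j (fun x' => comp h e x' s k) x))) := by
    intro i
    simp only [geodesicVec, leviCivitaCoeff, Finset.mul_sum, Finset.sum_mul]
    refine Eq.trans (Finset.sum_congr rfl fun j _ => Finset.sum_comm) (Finset.sum_comm.trans ?_)
    exact Finset.sum_congr rfl fun _ _ => Finset.sum_congr rfl fun _ _ =>
      Finset.sum_congr rfl fun _ _ => by ring
  simp only [h2]
  rw [sum_comp_mul_inv h he hx]
  have h3 : ∑ j, ∑ k, 1 / 2 * (u j * u k * pd j (fun x' => comp h e x' l k) x)
      = ∑ j, ∑ k, 1 / 2 * (u j * u k * pd k (fun x' => comp h e x' l j) x) := by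
    rw [Finset.sum_comm]
    exact Finset.sum_congr rfl fun _ _ => Finset.sum_congr rfl fun _ _ => by ring
  simp only [mul_add, mul_sub, Finset.sum_add_distrib, Finset.sum_sub_distrib, h3]
  simp only [← Finset.sum_add_distrib, ← Finset.sum_sub_distrib]
  exact Finset.sum_congr rfl fun _ _ => Finset.sum_congr rfl fun _ _ => by ring

/-- An index-free form of the lowered Christoffel symbols on the diagonal. It reduces the
transformation law to algebra with derivatives of the metric. -/
theorem pullForm_geodesicVec (he : e ∈ IsManifold.maximalAtlas (𝓡 n) ∞ M) (hx : x ∈ e.target)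
    (u v : Coord n) : pullForm h.inner e x (geodesicVec h e x u) v
      = compDeriv h e x u u v - 1 / 2 * compDeriv h e x v u u := by
  have h1 : pullForm h.inner e x (geodesicVec h e x u) v
      = ∑ l, v l * ∑ i, comp h e x l i * geodesicVec h e x u i := by
    rw [pullForm_symm, pullForm_eq_sum_comp]
    simp only [Finset.mul_sum]
    exact Finset.sum_congr rfl fun _ _ => Finset.sum_congr rfl fun _ _ => by ring
  have h2 : compDeriv h e x u u v
      = ∑ l, ∑ j, ∑ k, v l * (u j * u k * pd k (fun x' => comp h e x' l j) x) := by
    simp only [compDeriv, fderiv_eq_sum_pd, Finset.sum_mul]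
    rw [Finset.sum_comm]
    refine Finset.sum_congr rfl fun l _ => Finset.sum_congr rfl fun j _ =>
      Finset.sum_congr rfl fun k _ => ?_
    rw [pd_comp_symm h e x j l]
    ring
  have h3 : compDeriv h e x v u u
      = ∑ l, ∑ j, ∑ k, v l * (u j * u k * pd l (fun x' => comp h e x' j k) x) := by
    simp only [compDeriv, fderiv_eq_sum_pd, Finset.sum_mul]
    refine Eq.trans (Finset.sum_congr rfl fun j _ => Finset.sum_comm) (Finset.sum_comm.trans ?_)
    exact Finset.sum_congr rfl fun _ _ => Finset.sum_congr rfl fun _ _ =>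
      Finset.sum_congr rfl fun _ _ => by ring
  rw [h1, h2, h3]
  simp only [comp_geodesicVec h he hx, Finset.mul_sum, ← Finset.sum_sub_distrib]
  exact Finset.sum_congr rfl fun _ _ => Finset.sum_congr rfl fun _ _ =>
      Finset.sum_congr rfl fun _ _ => by ring

variable (e x) in
/-- The metric in the chart `e` as a continuous bilinear form. -/
def chartForm : Coord n →L[ℝ] Coord n →L[ℝ] ℝ :=
  ContinuousLinearMap.bilinearComp (h.inner (e.symm x)) (frame e x) (frame e x)

theorem pullForm_eq_chartForm (u v : Coord n) :
    pullForm h.inner e x u v = chartForm h e x u v := rfl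

theorem inner_congr_point {p p' : M} (hp : p = p') (a b : Coord n) :
    h.inner p a b = h.inner p' a b := by
  subst hp; rfl

theorem pullForm_transition (he : e ∈ IsManifold.maximalAtlas (𝓡 n) ∞ M)
    (he' : e' ∈ IsManifold.maximalAtlas (𝓡 n) ∞ M) (hx : x ∈ e.target)
    (hx' : e.symm x ∈ e'.source) (u v : Coord n) :
    pullForm h.inner e' (transition e e' x) (fderiv ℝ (transition e e') x u)
      (fderiv ℝ (transition e e') x v) = pullForm h.inner e x u v := by
  have h1 := frame_transition he he' hx hx' u
  have h2 := frame_transition he he' hx hx' v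
  have h3 : pullForm h.inner e x u v = h.inner (e.symm x) (frame e x u) (frame e x v) := rfl
  rw [h3, ← h1, ← h2]
  exact inner_congr_point h (e'.left_inv hx') _ _

/-- Differentiate the invariance of `h` under the coordinate change along the line `x + s w` at `s =
0`. The second derivatives come from the transported vectors, which vary with `s`. -/
theorem compDeriv_transition (he : e ∈ IsManifold.maximalAtlas (𝓡 n) ∞ M)
    (he' : e' ∈ IsManifold.maximalAtlas (𝓡 n) ∞ M) (hx : x ∈ e.target)
    (hx' : e.symm x ∈ e'.source) (w u v : Coord n) :
    compDeriv h e x w u v = compDeriv h e' (transition e e' x) (fderiv ℝ (transition e e') x w)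
        (fderiv ℝ (transition e e') x u) (fderiv ℝ (transition e e') x v)
      + pullForm h.inner e' (transition e e' x)
          (fderiv ℝ (fderiv ℝ (transition e e')) x w u) (fderiv ℝ (transition e e') x v)
      + pullForm h.inner e' (transition e e' x)
          (fderiv ℝ (transition e e') x u) (fderiv ℝ (fderiv ℝ (transition e e')) x w v) := by
  have hτ := contDiffAt_transition he he' hx hx'
  have hl : HasDerivAt (fun s : ℝ => x + s • w) w 0 := by
    simpa using ((hasDerivAt_id (0 : ℝ)).smul_const w).const_add x
  have hx0 : x + (0 : ℝ) • w = x := by simp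
  have hτ1 : HasFDerivAt (transition e e') (fderiv ℝ (transition e e') x) (x + (0 : ℝ) • w) := by
    rw [hx0]; exact (hτ.differentiableAt (by simp)).hasFDerivAt
  have hτ2 : HasFDerivAt (fderiv ℝ (transition e e')) (fderiv ℝ (fderiv ℝ (transition e e')) x)
      (x + (0 : ℝ) • w) := by
    rw [hx0]
    exact ((hτ.fderiv_right (m := ∞) (by simp)).differentiableAt (by simp)).hasFDerivAt
  have hz := hτ1.comp_hasDerivAt (0 : ℝ) hl
  have hD := hτ2.comp_hasDerivAt (0 : ℝ) hl
  have hDu : ∀ u : Coord n, HasDerivAt (fun s : ℝ => fderiv ℝ (transition e e') (x + s • w) u)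
      (fderiv ℝ (fderiv ℝ (transition e e')) x w u) 0 := fun u => by
    simpa using hD.clm_apply (hasDerivAt_const (0 : ℝ) u)
  have h1 := hasDerivAt_pullForm h he hl (hasDerivAt_const (0 : ℝ) u) (hasDerivAt_const (0 : ℝ) v)
    (by simpa using hx)
  have h2 := hasDerivAt_pullForm h he' hz (hDu u) (hDu v)
    (by simpa [transition] using e'.map_source hx')
  have h3 : (fun s : ℝ => pullForm h.inner e (x + s • w) u v) =ᶠ[𝓝 0] fun s =>
      pullForm h.inner e' ((transition e e' ∘ fun s : ℝ => x + s • w) s)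
        (fderiv ℝ (transition e e') (x + s • w) u) (fderiv ℝ (transition e e') (x + s • w) v) := by
    have hc : Filter.Tendsto (fun s : ℝ => x + s • w) (𝓝 0) (𝓝 x) := by
      simpa using hl.continuousAt.tendsto
    filter_upwards [hc.eventually (e.open_target.mem_nhds hx), hc.eventually
      ((e.symm.continuousAt hx).eventually_mem (e'.open_source.mem_nhds hx'))] with s hs hs'
    exact (pullForm_transition h he he' hs hs' u v).symm
  have h4 := h1.unique (h2.congr_of_eventuallyEq h3)
  simp only [Function.comp, hx0, pullForm_eq_chartForm, map_zero, zero_apply, add_zero] at h4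
  exact h4

theorem eq_of_pullForm_eq (he : e ∈ IsManifold.maximalAtlas (𝓡 n) ∞ M) (hx : x ∈ e.target)
    {u u' : Coord n} (huv : ∀ v, pullForm h.inner e x u v = pullForm h.inner e x u' v) :
    u = u' := by
  by_contra hne
  have h1 := pullForm_pos h he hx (sub_ne_zero.2 hne)
  have h2 := huv (u - u')
  simp only [pullForm_eq_chartForm] at h1 h2
  rw [map_sub (chartForm h e x), sub_apply, h2, sub_self] at h1
  exact lt_irrefl _ h1

/-- Geodesics are tested in every chart, while solutions are built in one; this law connects the
two. The terms with the mixed second derivative in `u` and `v` cancel by symmetry. -/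
theorem geodesicVec_transition (he : e ∈ IsManifold.maximalAtlas (𝓡 n) ∞ M)
    (he' : e' ∈ IsManifold.maximalAtlas (𝓡 n) ∞ M) (hx : x ∈ e.target)
    (hx' : e.symm x ∈ e'.source) (u : Coord n) :
    fderiv ℝ (transition e e') x (geodesicVec h e x u)
      = geodesicVec h e' (transition e e' x) (fderiv ℝ (transition e e') x u)
        + fderiv ℝ (fderiv ℝ (transition e e')) x u u := by
  have hz : transition e e' x ∈ e'.target := e'.map_source hx'
  refine eq_of_pullForm_eq h he' hz fun w => ?_
  obtain ⟨v, rfl⟩ := fderiv_transition_surjective he he' hx hx' w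
  have h1 : ∀ a b c : Coord n, pullForm h.inner e' (transition e e' x) (a + b) c
      = pullForm h.inner e' (transition e e' x) a c
        + pullForm h.inner e' (transition e e' x) b c := by
    intro a b c
    simp only [pullForm_eq_chartForm, map_add, add_apply]
  have hsymm : fderiv ℝ (fderiv ℝ (transition e e')) x u v
      = fderiv ℝ (fderiv ℝ (transition e e')) x v u :=
    (contDiffAt_transition he he' hx hx').isSymmSndFDerivAt (by
      rw [minSmoothness_of_isRCLikeNormedField]; exact WithTop.coe_le_coe.2 le_top) u v
  rw [pullForm_transition h he he' hx hx', h1, pullForm_geodesicVec h he hx,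
    pullForm_geodesicVec h he' hz, compDeriv_transition h he he' hx hx' u u v,
    compDeriv_transition h he he' hx hx' v u u, hsymm,
    pullForm_symm h e' _ (fderiv ℝ (fderiv ℝ (transition e e')) x v u)]
  ring

end RiemMetric
end Finsler

/-! ### Existence of Riemannian geodesics; affine equivalence implies Berwald. -/

namespace Finsler

namespace RiemMetric

variable {n : ℕ} {M : Type*} [TopologicalSpace M] [ChartedSpace (Coord n) M]
  [IsManifold (𝓡 n) ∞ M] (h : RiemMetric n M)
  {e : OpenPartialHomeomorph M (Coord n)}

theorem contDiffOn_leviCivitaCoeff (he : e ∈ IsManifold.maximalAtlas (𝓡 n) ∞ M) (i j k : Fin n) :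
    ContDiffOn ℝ ∞ (fun q : Coord n × Coord n => h.leviCivitaCoeff e q.1 q.2 i j k)
      (e.target ×ˢ univ) := by
  have hfst : ∀ {f : Coord n → ℝ}, ContDiffOn ℝ ∞ f e.target →
      ContDiffOn ℝ ∞ (fun q : Coord n × Coord n => f q.1) (e.target ×ˢ univ) := fun hf =>
    hf.comp contDiff_fst.contDiffOn fun q hq => hq.1
  have hinv : ∀ i s, ContDiffOn ℝ ∞ (fun q : Coord n × Coord n => (comp h e q.1)⁻¹ i s)
      (e.target ×ˢ univ) := contDiffOn_matrix_inv
    (A := fun q : Coord n × Coord n => comp h e q.1) (fun i j => hfst (contDiffOn_comp h he i j))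
      fun q hq => det_comp_ne_zero h he hq.1
  have hpd : ∀ i j k, ContDiffOn ℝ ∞
      (fun q : Coord n × Coord n => pd k (fun x' => comp h e x' i j) q.1) (e.target ×ˢ univ) :=
    fun i j k => hfst (((contDiffOn_comp h he i j).fderiv_of_isOpen e.open_target
      (by simp)).clm_apply contDiffOn_const)
  simp only [leviCivitaCoeff]
  exact contDiffOn_const.mul (ContDiffOn.sum fun s _ => (hinv i s).mul
    (((hpd _ _ _).sub (hpd _ _ _)).add (hpd _ _ _)))

theorem contDiffOn_geodesicVec (he : e ∈ IsManifold.maximalAtlas (𝓡 n) ∞ M) :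
    ContDiffOn ℝ ∞ (fun q : Coord n × Coord n => geodesicVec h e q.1 q.2) (e.target ×ˢ univ) := by
  rw [contDiffOn_euclidean]
  intro i
  simp only [geodesicVec]
  exact ContDiffOn.sum fun j _ => ContDiffOn.sum fun k _ =>
    ((contDiffOn_leviCivitaCoeff h he i j k).mul (contDiff_coord j).contDiffOn).mul
      (contDiff_coord k).contDiffOn

/-- Local existence of solutions of the geodesic equation in a chart. -/
theorem exists_local_solution (he : e ∈ IsManifold.maximalAtlas (𝓡 n) ∞ M) {x y : Coord n}
    (hx : x ∈ e.target) (hy : y ≠ 0) : ∃ δ > 0, ∃ X V : ℝ → Coord n, X 0 = x ∧ V 0 = y ∧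
      ∀ t ∈ Ioo (-δ) δ, X t ∈ e.target ∧ V t ≠ 0 ∧ HasDerivAt X (V t) t ∧
        HasDerivAt V (-geodesicVec h e (X t) (V t)) t := by
  -- The geodesic equation as a first-order system. The interval is shrunk below so that position
  -- stays in the chart and velocity stays non-zero.
  have hf : ContDiffAt ℝ 1 (fun q : Coord n × Coord n => (q.2, -geodesicVec h e q.1 q.2)) (x, y) := by
    have h1 : ContDiffAt ℝ ∞ (fun q : Coord n × Coord n => geodesicVec h e q.1 q.2) (x, y) :=
      (contDiffOn_geodesicVec h he).contDiffAt
        ((e.open_target.prod isOpen_univ).mem_nhds ⟨hx, mem_univ _⟩)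
    exact contDiffAt_snd.prodMk (h1.of_le (by simp)).neg
  obtain ⟨r, hr, ε, hε, hα⟩ :=
    hf.exists_forall_mem_closedBall_exists_eq_forall_mem_Ioo_hasDerivAt 0
  obtain ⟨α, hα0, hα'⟩ := hα (x, y) (Metric.mem_closedBall_self hr.le)
  have hc : ContinuousAt α 0 := (hα' 0 (by simp [hε])).continuousAt
  have hev : ∀ᶠ t in 𝓝 (0 : ℝ), α t ∈ slit e := hc.eventually_mem
    ((isOpen_slit e).mem_nhds (by rw [hα0]; exact ⟨hx, hy⟩))
  obtain ⟨δ', hδ', hball⟩ := Metric.eventually_nhds_iff_ball.1 hev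
  refine ⟨min ε δ', lt_min hε hδ', fun t => (α t).1, fun t => (α t).2, by simp [hα0],
    by simp [hα0], fun t ht => ?_⟩
  have ht1 : t ∈ Ioo (0 - ε) (0 + ε) := by
    constructor
    · linarith [ht.1, min_le_left ε δ']
    · linarith [ht.2, min_le_left ε δ']
  have ht2 : α t ∈ slit e := hball t (by
    rw [Metric.mem_ball, dist_zero_right, Real.norm_eq_abs, abs_lt]
    constructor
    · linarith [ht.1, min_le_right ε δ']
    · linarith [ht.2, min_le_right ε δ'])
  have h1 := hα' t ht1
  refine ⟨ht2.1, ht2.2, ?_, ?_⟩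
  · exact (hasFDerivAt_fst (𝕜 := ℝ) (p := α t)).comp_hasDerivAt t h1
  · exact (hasFDerivAt_snd (𝕜 := ℝ) (p := α t)).comp_hasDerivAt t h1

/-- The equation makes `V'` continuous, so `X` is `C²`; other charts are reached through the
transformation law. -/
theorem isGeodesicOn_of_solution (he : e ∈ IsManifold.maximalAtlas (𝓡 n) ∞ M) {δ : ℝ}
    {X V : ℝ → Coord n} (hXV : ∀ t ∈ Ioo (-δ) δ, X t ∈ e.target ∧ V t ≠ 0 ∧
      HasDerivAt X (V t) t ∧ HasDerivAt V (-geodesicVec h e (X t) (V t)) t) :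
    IsGeodesicOn h.leviCivitaCoeff (fun t => e.symm (X t)) (Ioo (-δ) δ) := by
  have hXc : ContinuousOn X (Ioo (-δ) δ) := fun t ht =>
    (hXV t ht).2.2.1.continuousAt.continuousWithinAt
  have hVc : ContinuousOn V (Ioo (-δ) δ) := fun t ht =>
    (hXV t ht).2.2.2.continuousAt.continuousWithinAt
  have hV1 : ContDiffOn ℝ 1 V (Ioo (-δ) δ) := by
    rw [← zero_add (1 : ℕ∞ω), contDiffOn_succ_iff_deriv_of_isOpen isOpen_Ioo, contDiffOn_zero]
    refine ⟨fun t ht => (hXV t ht).2.2.2.differentiableAt.differentiableWithinAt, by simp, ?_⟩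
    have h1 : ContinuousOn (fun t => -geodesicVec h e (X t) (V t)) (Ioo (-δ) δ) :=
      ((contDiffOn_geodesicVec h he).continuousOn.comp (f := fun t => (X t, V t))
        (hXc.prodMk hVc) fun t ht => ⟨(hXV t ht).1, mem_univ _⟩).neg
    exact h1.congr fun t ht => (hXV t ht).2.2.2.deriv
  have hX2 : ContDiffOn ℝ 2 X (Ioo (-δ) δ) := by
    have : (2 : ℕ∞ω) = 1 + 1 := by norm_num
    rw [this, contDiffOn_succ_iff_deriv_of_isOpen isOpen_Ioo]
    refine ⟨fun t ht => (hXV t ht).2.2.1.differentiableAt.differentiableWithinAt, by simp, ?_⟩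
    exact hV1.congr fun t ht => (hXV t ht).2.2.1.deriv
  refine ⟨?_, fun e' he' t ht hct => ?_⟩
  · exact ((contMDiffOn_symm_of_mem_maximalAtlas he).of_le (WithTop.coe_le_coe.2 le_top)).comp
      hX2.contMDiffOn fun t ht => (hXV t ht).1
  · have hderiv : ∀ s ∈ Ioo (-δ) δ, e.symm (X s) ∈ e'.source →
        HasDerivAt (fun s => e' (e.symm (X s))) (fderiv ℝ (transition e e') (X s) (V s)) s := by
      intro s hs hs'
      have h1 := (contDiffAt_transition he he' (hXV s hs).1 hs').differentiableAt (by simp)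
      exact h1.hasFDerivAt.comp_hasDerivAt s (hXV s hs).2.2.1
    have hnear : ∀ᶠ s in 𝓝 t, s ∈ Ioo (-δ) δ ∧ e.symm (X s) ∈ e'.source := by
      have hc : ContinuousAt (fun s => e.symm (X s)) t :=
        (e.symm.continuousAt (hXV t ht).1).comp (hXV t ht).2.2.1.continuousAt
      exact Filter.Eventually.and (isOpen_Ioo.mem_nhds ht) (hc.eventually_mem (e'.open_source.mem_nhds hct))
    have hd : deriv (fun s => e' (e.symm (X s))) =ᶠ[𝓝 t]
        fun s => fderiv ℝ (transition e e') (X s) (V s) := by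
      filter_upwards [hnear] with s hs using (hderiv s hs.1 hs.2).deriv
    have hxt := (hXV t ht).1
    -- The second derivative of the coordinate change in the product rule is absorbed by the
    -- inhomogeneous term of `geodesicVec_transition`.
    have h2 : HasDerivAt (fun s => fderiv ℝ (transition e e') (X s) (V s))
        (-geodesicVec h e' (e' (e.symm (X t))) (fderiv ℝ (transition e e') (X t) (V t))) t := by
      have hD := (((contDiffAt_transition he he' hxt hct).fderiv_right (m := ∞)
        (by simp)).differentiableAt (by simp)).hasFDerivAt.comp_hasDerivAt t (hXV t ht).2.2.1
      refine (hD.clm_apply (hXV t ht).2.2.2).congr_deriv ?_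
      have h3 := geodesicVec_transition h he he' hxt hct (V t)
      simp only [transition] at h3 ⊢
      simp only [Function.comp, map_neg, h3]
      abel
    have h4 := (hderiv t ht hct).deriv
    have h5 : deriv (deriv fun s => e' (e.symm (X s))) t = _ := hd.deriv_eq.trans h2.deriv
    refine ⟨?_, fun i => ?_⟩
    · rw [h4]
      exact fderiv_transition_ne_zero he he' hxt hct (hXV t ht).2.1
    · rw [h5, h4]
      simp [geodesicVec]

/-- A metric with the same geodesics as the linear Berwald connection has the same spray. -/
theorem spray_eq_of_affinelyEquivalent {F : FinslerStructure n M}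
    (hF : AffinelyEquivalent h F) (he : e ∈ IsManifold.maximalAtlas (𝓡 n) ∞ M)
    {x y : Coord n} (hx : x ∈ e.target) (hy : y ≠ 0) (i : Fin n) :
    F.spray e x y i = ∑ j, ∑ k, h.leviCivitaCoeff e x y i j k * y j * y k := by
  obtain ⟨δ, hδ, X, V, hX0, hV0, hXV⟩ := exists_local_solution h he hx hy
  have hgeo := (hF (Ioo (-δ) δ) isOpen_Ioo ordConnected_Ioo _).1
    (isGeodesicOn_of_solution h he hXV)
  have h0 : (0 : ℝ) ∈ Ioo (-δ) δ := by simp [hδ]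
  have hs : e.symm (X 0) ∈ e.source := e.map_target (hXV 0 h0).1
  -- At time `0` the acceleration is the Levi-Civita term by construction, whereas the Berwald
  -- geodesic equation expresses it through the spray.
  have h1 := (hgeo.2 e he 0 h0 hs).2 i
  have h2 : (fun s => e (e.symm (X s))) =ᶠ[𝓝 0] X := by
    filter_upwards [isOpen_Ioo.mem_nhds h0] with s hs using e.right_inv (hXV s hs).1
  have h3 : deriv (fun s => e (e.symm (X s))) =ᶠ[𝓝 0] V := by
    refine h2.deriv.trans ?_
    filter_upwards [isOpen_Ioo.mem_nhds h0] with s hs using (hXV s hs).2.2.1.deriv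
  rw [h3.deriv_eq, (hXV 0 h0).2.2.2.deriv, h3.eq_of_nhds, hV0] at h1
  simp only [hX0] at h1
  rw [e.right_inv hx,
    FinslerStructure.sum_berwaldCoeff he hx hy] at h1
  have h4 : (-geodesicVec h e x y) i = -geodesicVec h e x y i := rfl
  rw [h4] at h1
  have h5 : geodesicVec h e x y i = ∑ j, ∑ k, h.leviCivitaCoeff e x y i j k * y j * y k := rfl
  linarith

theorem isBerwald_of_affinelyEquivalent {F : FinslerStructure n M}
    (hF : AffinelyEquivalent h F) : F.IsBerwald := by
  intro e he x hx y y' hy hy'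
  have h1 : ∀ y, y ≠ 0 → F.chernCoeff e x y = h.leviCivitaCoeff e x 0 := fun y hy =>
    FinslerStructure.chernCoeff_eq_of_spray_eq he hx (leviCivitaCoeff_symm h e x 0)
      (fun z hz i => spray_eq_of_affinelyEquivalent h hF he hx hz i) hy
  rw [h1 y hy, h1 y' hy']

end RiemMetric
end Finsler

/-! ### Integrals over the fibre depending on the base point. -/

namespace Finsler

section ParametricIntegral

open MeasureTheory

variable {n : ℕ} {S K : Set (Coord n)} {W : Coord n × Coord n → ℝ}

/-- The integral is the value at `0` of the convolution of the constant `1` with `W(x, ·)`, whose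
support lies in the fixed compact set `K`. Smoothness of convolutions with a parameter applies. -/
theorem contDiffOn_integral_fiber (hS : IsOpen S) (hK : IsCompact K)
    (hW : ContDiffOn ℝ ∞ W (S ×ˢ univ)) (h0 : ∀ x ∈ S, ∀ y ∉ K, W (x, y) = 0) :
    ContDiffOn ℝ ∞ (fun x => ∫ y, W (x, y)) S := by
  have h1 := contDiffOn_convolution_right_with_param (𝕜 := ℝ) (μ := (volume : Measure (Coord n)))
    (f := fun _ => (1 : ℝ)) (n := ⊤) (ContinuousLinearMap.mul ℝ ℝ) (g := fun x y => W (x, y))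
    hS hK (fun p x hp hx => h0 p hp x hx) (locallyIntegrable_const 1) hW
  have h2 := h1.comp (s := S) (f := fun x : Coord n => (x, (0 : Coord n)))
    (contDiff_prodMk_left 0).contDiffOn fun x hx => ⟨hx, mem_univ _⟩
  refine h2.congr fun x _ => ?_
  simp only [Function.comp, convolution, ContinuousLinearMap.mul_apply', one_mul, zero_sub]
  exact (integral_neg_eq_self (fun y => W (x, y)) volume).symm

theorem continuous_slice {x : Coord n} (hW : ContDiffOn ℝ ∞ W (S ×ˢ univ)) (hx : x ∈ S) :
    Continuous fun y => W (x, y) :=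
  hW.continuousOn.comp_continuous (by fun_prop) fun _ => ⟨hx, mem_univ _⟩

theorem hasCompactSupport_slice {x : Coord n} (hK : IsCompact K) (hx : x ∈ S)
    (h0 : ∀ x ∈ S, ∀ y ∉ K, W (x, y) = 0) : HasCompactSupport fun y => W (x, y) :=
  HasCompactSupport.intro hK fun y hy => h0 x hx y hy

theorem dirDeriv_eq_zero_of_notMem (hS : IsOpen S) (hK : IsCompact K)
    (h0 : ∀ x ∈ S, ∀ y ∉ K, W (x, y) = 0) {x y : Coord n} (hx : x ∈ S) (hy : y ∉ K)
    (w : Coord n × Coord n) : dirDeriv w W (x, y) = 0 := by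
  have h1 : W =ᶠ[𝓝 (x, y)] fun _ => 0 := by
    filter_upwards [(hS.prod hK.isClosed.isOpen_compl).mem_nhds ⟨hx, hy⟩] with q hq
    exact h0 q.1 hq.1 q.2 hq.2
  simp [dirDeriv, h1.fderiv_eq]

theorem fderiv_integral_fiber (hS : IsOpen S) (hK : IsCompact K)
    (hW : ContDiffOn ℝ ∞ W (S ×ˢ univ)) (h0 : ∀ x ∈ S, ∀ y ∉ K, W (x, y) = 0) {x : Coord n}
    (hx : x ∈ S) (w : Coord n) :
    fderiv ℝ (fun x => ∫ y, W (x, y)) x w = ∫ y, dirDeriv (w, 0) W (x, y) := by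
  have h1 := hasFDerivAt_convolution_right_with_param (𝕜 := ℝ)
    (μ := (volume : Measure (Coord n)))
    (f := fun _ => (1 : ℝ)) (ContinuousLinearMap.mul ℝ ℝ) (g := fun x y => W (x, y))
    hS hK (fun p x hp hx => h0 p hp x hx) (locallyIntegrable_const 1) (hW.of_le (by simp))
    (x, 0) hx
  have h2 := HasFDerivAt.comp (𝕜 := ℝ) x h1
    (hasFDerivAt_prodMk_left (𝕜 := ℝ) x (0 : Coord n))
  have h3 : (fun x => ∫ y, W (x, y)) = (fun q : Coord n × Coord n =>
      convolution (fun _ => (1 : ℝ)) (fun y => W (q.1, y)) (ContinuousLinearMap.mul ℝ ℝ) volume q.2)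
        ∘ fun x => (x, (0 : Coord n)) := by
    funext x
    simp only [Function.comp, convolution, ContinuousLinearMap.mul_apply', one_mul, zero_sub]
    exact (integral_neg_eq_self (fun y => W (x, y)) volume).symm
  rw [h3, h2.fderiv]
  simp only [convolution, zero_sub, ContinuousLinearMap.comp_apply]
  have h4 : Continuous fun y => fderiv ℝ W (x, y) :=
    ((hW.fderiv_of_isOpen (m := ∞) (hS.prod isOpen_univ) (by simp)).continuousOn).comp_continuous
      (by fun_prop) fun _ => ⟨hx, mem_univ _⟩
  have h5 : HasCompactSupport fun y => fderiv ℝ W (x, y) :=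
    HasCompactSupport.intro hK fun y hy => by
      ext w
      · exact dirDeriv_eq_zero_of_notMem hS hK h0 hx hy _
      · exact dirDeriv_eq_zero_of_notMem hS hK h0 hx hy _
  have h6 : ∀ t : Coord n, (ContinuousLinearMap.precompR (Coord n × Coord n)
      (ContinuousLinearMap.mul ℝ ℝ)) 1 (fderiv ℝ W (x, -t)) = fderiv ℝ W (x, -t) := fun t => by
    ext w <;> simp [ContinuousLinearMap.precompR_apply]
  erw [integral_congr_ae (Filter.Eventually.of_forall h6)]
  rw [integral_neg_eq_self (fun y => fderiv ℝ W (x, y)) volume,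
    ContinuousLinearMap.integral_apply (h4.integrable_of_hasCompactSupport h5)]
  rfl

end ParametricIntegral
end Finsler

/-! ### Cut-off functions on the fibres and integration by parts. -/

namespace Finsler

/-- A smooth cut-off function on the real line, supported in `[1, 3]`. -/
def cutoff : ContDiffBump (2 : ℝ) := ⟨1 / 2, 1, by norm_num, by norm_num⟩

theorem cutoff_eq_zero {t : ℝ} (ht : t ≤ 1 ∨ 3 ≤ t) : cutoff t = 0 := by
  apply cutoff.zero_of_le_dist
  rw [Real.dist_eq]
  change (1 : ℝ) ≤ |t - 2|
  rcases ht with ht | ht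
  · rw [abs_of_nonpos (by linarith)]; linarith
  · rw [abs_of_nonneg (by linarith)]; linarith

theorem cutoff_two : cutoff (2 : ℝ) = 1 :=
  cutoff.one_of_mem_closedBall (Metric.mem_closedBall_self (by simp [cutoff]))

namespace FinslerStructure

open MeasureTheory

variable {n : ℕ} {M : Type*} [TopologicalSpace M] [ChartedSpace (Coord n) M]
  [IsManifold (𝓡 n) ∞ M] (F : FinslerStructure n M)
  {e : OpenPartialHomeomorph M (Coord n)} {x y : Coord n}

theorem toFun_zero (p : M) : F.toFun ⟨p, 0⟩ = 0 := by
  have := F.homog p 0 2 (by norm_num)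
  rw [smul_zero] at this
  linarith

theorem energy_zero (e : OpenPartialHomeomorph M (Coord n)) (x : Coord n) :
    F.energy e (x, 0) = 0 := by
  have h1 : localRep F.toFun e x 0 = 0 := by
    simp only [localRep, natPoint_eq_frame, map_zero]
    exact F.toFun_zero _
  simp [energy, h1]

/-- Compactness bounds `F²` and `1/F²` on unit vectors over a neighbourhood, and homogeneity extends
the bounds. One bound makes the cut-off vanish near `y = 0`, the other confines its support to a
ball uniform in `x`. -/
theorem exists_energy_bounds (he : e ∈ IsManifold.maximalAtlas (𝓡 n) ∞ M) {x₀ : Coord n}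
    (hx₀ : x₀ ∈ e.target) : ∃ S : Set (Coord n), IsOpen S ∧ x₀ ∈ S ∧ S ⊆ e.target ∧
      ∃ B : ℝ, 0 < B ∧ ∀ x ∈ S, ∀ y, ‖y‖ ^ 2 ≤ B * F.energy e (x, y) ∧
        F.energy e (x, y) ≤ B * ‖y‖ ^ 2 := by
  obtain ⟨C, hC, hxC, hCt⟩ := exists_compact_subset e.open_target hx₀
  have hK : IsCompact (C ×ˢ Metric.sphere (0 : Coord n) 1) := hC.prod (isCompact_sphere 0 1)
  have hsub : C ×ˢ Metric.sphere (0 : Coord n) 1 ⊆ slit e := fun q hq =>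
    ⟨hCt hq.1, fun h => by
      have h2 := hq.2
      rw [h] at h2
      simp at h2⟩
  have hc : ContinuousOn (F.energy e) (C ×ˢ Metric.sphere (0 : Coord n) 1) :=
    (F.contDiffOn_energy he).continuousOn.mono hsub
  obtain ⟨B₁, hB₁⟩ := hK.bddAbove_image hc
  obtain ⟨B₂, hB₂⟩ := hK.bddAbove_image (hc.inv₀ fun q hq => (energy_pos he (hsub hq)).ne')
  refine ⟨interior C, isOpen_interior, hxC, interior_subset.trans hCt, max 1 (max B₁ B₂),
    by positivity, fun x hx y => ?_⟩
  rcases eq_or_ne y 0 with rfl | hy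
  · simp [energy_zero]
  have hn : 0 < ‖y‖ := norm_pos_iff.2 hy
  have hq : (x, ‖y‖⁻¹ • y) ∈ C ×ˢ Metric.sphere (0 : Coord n) 1 :=
    ⟨interior_subset hx, by simp [norm_smul, hn.ne']⟩
  have h1 : F.energy e (x, y) = ‖y‖ ^ 2 * F.energy e (x, ‖y‖⁻¹ • y) := by
    rw [← F.energy_smul e x _ hn, smul_smul, mul_inv_cancel₀ hn.ne', one_smul]
  have h2 : F.energy e (x, ‖y‖⁻¹ • y) ≤ max 1 (max B₁ B₂) :=
    (hB₁ (mem_image_of_mem _ hq)).trans ((le_max_left _ _).trans (le_max_right _ _))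
  have h3 : (F.energy e (x, ‖y‖⁻¹ • y))⁻¹ ≤ max 1 (max B₁ B₂) :=
    (hB₂ (mem_image_of_mem _ hq)).trans ((le_max_right _ _).trans (le_max_right _ _))
  have h4 : 0 < F.energy e (x, ‖y‖⁻¹ • y) := energy_pos he (hsub hq)
  have h5 : 1 ≤ max 1 (max B₁ B₂) * F.energy e (x, ‖y‖⁻¹ • y) := by
    rw [inv_le_iff_one_le_mul₀ h4] at h3
    linarith
  rw [h1]
  constructor
  · nlinarith [sq_nonneg ‖y‖]
  · nlinarith [sq_nonneg ‖y‖]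

/-- The function `f` of the natural coordinates, cut off away from the indicatrix. -/
def weighted (e : OpenPartialHomeomorph M (Coord n)) (f : Coord n × Coord n → ℝ)
    (q : Coord n × Coord n) : ℝ := cutoff (F.energy e q) * f q

variable {F} {f r : Coord n × Coord n → ℝ} (he : e ∈ IsManifold.maximalAtlas (𝓡 n) ∞ M)
include he

/-- Near the zero section `F² < 1`, where the cut-off is zero. Hence `f` need only be smooth on the
slit domain. -/
theorem weighted_eventuallyEq_zero (f : Coord n × Coord n → ℝ) (hx : x ∈ e.target) :
    F.weighted e f =ᶠ[𝓝 (x, 0)] fun _ => 0 := by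
  obtain ⟨S, hS, hxS, -, B, hB, hb⟩ := F.exists_energy_bounds he hx
  have h1 : ∀ᶠ q : Coord n × Coord n in 𝓝 (x, 0), B * ‖q.2‖ ^ 2 < 1 := by
    have : ContinuousAt (fun q : Coord n × Coord n => B * ‖q.2‖ ^ 2) (x, 0) := by fun_prop
    exact this.eventually_lt continuousAt_const (by simp)
  have h2 : ∀ᶠ q : Coord n × Coord n in 𝓝 (x, 0), q.1 ∈ S :=
    continuousAt_fst.eventually_mem (hS.mem_nhds hxS)
  filter_upwards [h1, h2] with q hq1 hq2
  simp only [weighted]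
  rw [cutoff_eq_zero (Or.inl ((hb q.1 hq2 q.2).2.trans hq1.le)), zero_mul]

theorem contDiffOn_weighted (hf : ContDiffOn ℝ ∞ f (slit e)) :
    ContDiffOn ℝ ∞ (F.weighted e f) (e.target ×ˢ univ) := by
  rintro ⟨x, y⟩ ⟨hx, -⟩
  refine ContDiffAt.contDiffWithinAt ?_
  rcases eq_or_ne y 0 with rfl | hy
  · exact contDiffAt_const.congr_of_eventuallyEq (weighted_eventuallyEq_zero he f hx)
  · have hn := (isOpen_slit e).mem_nhds (show (x, y) ∈ slit e from ⟨hx, hy⟩)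
    exact (cutoff.contDiff.contDiffAt.comp (x, y) ((F.contDiffOn_energy he).contDiffAt hn)).mul
      (hf.contDiffAt hn)

omit he in
theorem weighted_eq_zero_of_notMem {S : Set (Coord n)} {B : ℝ} (hB : 0 < B)
    (hb : ∀ x ∈ S, ∀ y, ‖y‖ ^ 2 ≤ B * F.energy e (x, y)) (f : Coord n × Coord n → ℝ) :
    ∀ x ∈ S, ∀ y ∉ Metric.closedBall (0 : Coord n) (3 * B + 1), F.weighted e f (x, y) = 0 := by
  intro x hx y hy
  rw [mem_closedBall_zero_iff, not_le] at hy
  have h1 := hb x hx y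
  simp only [weighted]
  rw [cutoff_eq_zero (Or.inr ?_), zero_mul]
  -- If `F² < 3`, then `‖y‖² < 3B`, contradicting `‖y‖ > 3B + 1`.
  by_contra hlt
  rw [not_le] at hlt
  nlinarith

theorem continuous_weighted (hf : ContDiffOn ℝ ∞ f (slit e)) (hx : x ∈ e.target) :
    Continuous fun y => F.weighted e f (x, y) :=
  continuous_slice (contDiffOn_weighted he hf) hx

theorem hasCompactSupport_weighted (f : Coord n × Coord n → ℝ) (hx : x ∈ e.target) :
    HasCompactSupport fun y => F.weighted e f (x, y) := by
  obtain ⟨S, hS, hxS, -, B, hB, hb⟩ := F.exists_energy_bounds he hx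
  exact hasCompactSupport_slice (isCompact_closedBall 0 (3 * B + 1)) hxS
    (weighted_eq_zero_of_notMem hB (fun x hx y => (hb x hx y).1) f)

theorem integrable_weighted (hf : ContDiffOn ℝ ∞ f (slit e)) (hx : x ∈ e.target) :
    Integrable fun y => F.weighted e f (x, y) :=
  (continuous_weighted he hf hx).integrable_of_hasCompactSupport (hasCompactSupport_weighted he f hx)

theorem contDiffOn_integral_weighted (hf : ContDiffOn ℝ ∞ f (slit e)) :
    ContDiffOn ℝ ∞ (fun x => ∫ y, F.weighted e f (x, y)) e.target := by
  intro x hx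
  obtain ⟨S, hS, hxS, hSt, B, hB, hb⟩ := F.exists_energy_bounds he hx
  exact ((contDiffOn_integral_fiber hS (isCompact_closedBall 0 (3 * B + 1))
    ((contDiffOn_weighted he hf).mono (prod_mono hSt Subset.rfl))
    (weighted_eq_zero_of_notMem hB (fun x hx y => (hb x hx y).1) f)).contDiffAt
      (hS.mem_nhds hxS)).contDiffWithinAt

theorem pd_integral_weighted (hf : ContDiffOn ℝ ∞ f (slit e)) (hx : x ∈ e.target) (k : Fin n) :
    pd k (fun x => ∫ y, F.weighted e f (x, y)) x = ∫ y, dX k (F.weighted e f) (x, y) := by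
  obtain ⟨S, hS, hxS, hSt, B, hB, hb⟩ := F.exists_energy_bounds he hx
  exact fderiv_integral_fiber hS (isCompact_closedBall 0 (3 * B + 1))
    ((contDiffOn_weighted he hf).mono (prod_mono hSt Subset.rfl))
    (weighted_eq_zero_of_notMem hB (fun x hx y => (hb x hx y).1) f) hxS _

/-- Integration by parts without boundary term, thanks to compact support. Summed over `m`, the
constants `a m` become the trace of the connection. -/
theorem integral_linear_mul_dY_weighted (hf : ContDiffOn ℝ ∞ f (slit e)) (hx : x ∈ e.target)
    (a : Fin n → ℝ) (m : Fin n) :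
    Integrable (fun y : Coord n => (∑ l, y l * a l) * dY m (F.weighted e f) (x, y)) ∧
    ∫ y : Coord n, (∑ l, y l * a l) * dY m (F.weighted e f) (x, y)
      = -(a m * ∫ y, F.weighted e f (x, y)) := by
  have hW := contDiffOn_weighted (F := F) he hf
  have ho : IsOpen (e.target ×ˢ (univ : Set (Coord n))) := e.open_target.prod isOpen_univ
  have hWd : ∀ y, DifferentiableAt ℝ (F.weighted e f) (x, y) := fun y =>
    ContDiffOn.differentiableAt_of_isOpen hW ho ⟨hx, mem_univ _⟩
  have hc := continuous_weighted (F := F) he hf hx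
  have hs := hasCompactSupport_weighted (F := F) he f hx
  have hpd : ∀ y, dY m (F.weighted e f) (x, y)
      = fderiv ℝ (fun y => F.weighted e f (x, y)) y (EuclideanSpace.single m 1) := fun y =>
    (pd_snd_eq_dY (hWd y) m).symm
  have hc' : Continuous fun y => dY m (F.weighted e f) (x, y) :=
    continuous_slice (contDiffOn_dirDeriv hW ho _) hx
  have hs' : HasCompactSupport fun y => dY m (F.weighted e f) (x, y) := by
    simp only [hpd]
    exact hs.fderiv_apply ℝ _
  have hl : Continuous fun y : Coord n => ∑ l, y l * a l := by fun_prop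
  have hld : ∀ y : Coord n, fderiv ℝ (fun y : Coord n => ∑ l, y l * a l) y
      (EuclideanSpace.single m 1) = a m := fun y => by
    have := pd_sum_mul_coord a m y
    simpa only [pd, mul_comm] using this
  have hint : Integrable (fun y : Coord n => (∑ l, y l * a l) * dY m (F.weighted e f) (x, y)) :=
    (hl.mul hc').integrable_of_hasCompactSupport hs'.mul_left
  refine ⟨hint, ?_⟩
  have key := integral_mul_fderiv_eq_neg_fderiv_mul_of_integrable (𝕜 := ℝ)
    (μ := (volume : Measure (Coord n))) (f := fun y : Coord n => ∑ l, y l * a l)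
    (g := fun y => F.weighted e f (x, y)) (v := EuclideanSpace.single m 1) ?_ ?_ ?_ ?_ ?_
  · simp only [← hpd, hld] at key
    rw [key, integral_const_mul]
  · simp only [hld]
    exact (integrable_weighted he hf hx).const_mul _
  · simpa only [← hpd] using hint
  · exact (hl.mul hc).integrable_of_hasCompactSupport hs.mul_left
  · fun_prop
  · exact fun y _ => (hWd y).comp y (hasFDerivAt_prodMk_right x y).differentiableAt

end FinslerStructure
end Finsler

/-! ### The fibre average: smoothness, positivity and parallelism. -/

namespace Finsler

namespace FinslerStructure

open MeasureTheory

variable {n : ℕ} {M : Type*} [TopologicalSpace M] [ChartedSpace (Coord n) M]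
  [IsManifold (𝓡 n) ∞ M] {F : FinslerStructure n M}
  {e e' : OpenPartialHomeomorph M (Coord n)} {x y : Coord n}

section Transport

variable {f r : Coord n × Coord n → ℝ} (he : e ∈ IsManifold.maximalAtlas (𝓡 n) ∞ M)
include he

theorem dirDeriv_weighted (hf : ContDiffOn ℝ ∞ f (slit e)) {q : Coord n × Coord n}
    (hq : q ∈ slit e) (w : Coord n × Coord n) : dirDeriv w (F.weighted e f) q
      = deriv cutoff (F.energy e q) * dirDeriv w (F.energy e) q * f q
        + cutoff (F.energy e q) * dirDeriv w f q := by
  have h1 : HasFDerivAt (F.energy e) (fderiv ℝ (F.energy e) q) q :=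
    (differentiableAt_of_slit (F.contDiffOn_energy he) hq).hasFDerivAt
  have h2 : HasDerivAt cutoff (deriv cutoff (F.energy e q)) (F.energy e q) :=
    ((cutoff.contDiff (n := 1)).differentiable (by simp) _).hasDerivAt
  have h3 := (h2.comp_hasFDerivAt q h1).mul (differentiableAt_of_slit hf hq).hasFDerivAt
  have h4 : dirDeriv w (F.weighted e f) q = _ := congrArg (fun T => T w) h3.fderiv
  rw [h4]
  simp [dirDeriv]
  ring

theorem dirDeriv_weighted_zero (f : Coord n × Coord n → ℝ) (hx : x ∈ e.target)
    (w : Coord n × Coord n) : dirDeriv w (F.weighted e f) (x, 0) = 0 := by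
  simp [dirDeriv, (weighted_eventuallyEq_zero (F := F) he f hx).fderiv_eq]

theorem weighted_zero (f : Coord n × Coord n → ℝ) (hx : x ∈ e.target) :
    F.weighted e f (x, 0) = 0 :=
  (weighted_eventuallyEq_zero (F := F) he f hx).eq_of_nhds

/-- If `f` is transported by a linear non-linear connection up to `r`, then so is its weighted
integral over the fibres, up to the trace of the connection. -/
theorem pd_integral_weighted_of_transport (hf : ContDiffOn ℝ ∞ f (slit e))
    (hr : ContDiffOn ℝ ∞ r (slit e)) (hx : x ∈ e.target) {Γ : Fin n → Fin n → Fin n → ℝ}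
    (hN : ∀ y, y ≠ 0 → ∀ i j, F.nonlin e x y i j = ∑ k, y k * Γ i j k) (k : Fin n)
    (ht : ∀ y, y ≠ 0 → dX k f (x, y)
      = ∑ m, (∑ l, y l * Γ m k l) * dY m f (x, y) + r (x, y)) :
    pd k (fun x => ∫ y, F.weighted e f (x, y)) x
      = -((∑ m, Γ m k m) * ∫ y, F.weighted e f (x, y)) + ∫ y, F.weighted e r (x, y) := by
  -- Since `F²` is horizontally constant, the cut-off factor obeys the homogeneous transport
  -- equation, so the product inherits that of `f`. At `y = 0` everything vanishes.
  have h1 : ∀ y : Coord n, dX k (F.weighted e f) (x, y)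
      = ∑ m, (∑ l, y l * Γ m k l) * dY m (F.weighted e f) (x, y) + F.weighted e r (x, y) := by
    intro y
    rcases eq_or_ne y 0 with rfl | hy
    · simp [dX, weighted_zero he r hx, dirDeriv_weighted_zero he f hx]
    have hq : (x, y) ∈ slit e := ⟨hx, hy⟩
    have hE := dX_energy_eq (F := F) he hq k
    have h2 := ht y hy
    simp only [hN y hy] at hE
    simp only [dX, dY, energyDY] at hE h2 ⊢
    simp only [dirDeriv_weighted he hf hq, hE, h2, weighted, mul_add, Finset.mul_sum,
      Finset.sum_mul, Finset.sum_add_distrib, ← add_assoc]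
    congr 1
    congr 1 <;>
    exact Finset.sum_congr rfl fun _ _ => Finset.sum_congr rfl fun _ _ => by ring
  rw [pd_integral_weighted he hf hx]
  simp only [h1]
  have h3 := fun m => integral_linear_mul_dY_weighted (F := F) he hf hx (Γ m k) m
  rw [integral_add (integrable_finsetSum _ fun m _ => (h3 m).1) (integrable_weighted he hr hx),
    integral_finsetSum _ fun m _ => (h3 m).1]
  rw [Finset.sum_congr rfl fun m _ => (h3 m).2]
  simp only [Finset.sum_neg_distrib, Finset.sum_mul]

end Transport

variable (F) in
/-- The derivative of `F²` along the fibre in the direction `u`. -/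
def energyDir (e : OpenPartialHomeomorph M (Coord n)) (u : Coord n) : Coord n × Coord n → ℝ :=
  dirDeriv (0, u) (F.energy e)

variable (F) in
/-- The weighted mean over the fibre of `d(F²)(u) d(F²)(v)`. -/
def meanForm (e : OpenPartialHomeomorph M (Coord n)) (x u v : Coord n) : ℝ :=
  (∫ y, F.weighted e (fun _ => 1) (x, y))⁻¹ *
    ∫ y, F.weighted e (fun q => F.energyDir e u q * F.energyDir e v q) (x, y)

theorem energyDir_eq_sum (u : Coord n) (q : Coord n × Coord n) :
    F.energyDir e u q = ∑ i, u i * F.energyDY e i q := by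
  have h1 : ((0 : Coord n), u) = ∑ k, u k • ((0 : Coord n), EuclideanSpace.single k (1 : ℝ)) := by
    have h2 : u = ∑ i, u i • EuclideanSpace.single i (1 : ℝ) := by
      simpa using ((EuclideanSpace.basisFun (Fin n) ℝ).sum_repr u).symm
    refine Prod.ext ?_ ?_
    · simp [Prod.fst_sum]
    · simpa [Prod.snd_sum] using h2
  simp only [energyDir, dirDeriv]
  rw [h1]
  simp only [map_sum, map_smul, smul_eq_mul, energyDY, dY, dirDeriv]

section MeanForm

variable (he : e ∈ IsManifold.maximalAtlas (𝓡 n) ∞ M)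
include he

theorem contDiffOn_energyDir (u : Coord n) : ContDiffOn ℝ ∞ (F.energyDir e u) (slit e) :=
  contDiffOn_dirDeriv (F.contDiffOn_energy he) (isOpen_slit e) _

theorem contDiffOn_energyDir_mul (u v : Coord n) :
    ContDiffOn ℝ ∞ (fun q => F.energyDir e u q * F.energyDir e v q) (slit e) :=
  (contDiffOn_energyDir he u).mul (contDiffOn_energyDir he v)

theorem meanForm_eq_sum (hx : x ∈ e.target) (u v : Coord n) :
    F.meanForm e x u v = ∑ i, ∑ j, F.meanForm e x (EuclideanSpace.single i 1)
      (EuclideanSpace.single j 1) * (u i * v j) := by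
  have h1 : ∀ y, F.weighted e (fun q => F.energyDir e u q * F.energyDir e v q) (x, y)
      = ∑ i, ∑ j, F.weighted e (fun q => F.energyDir e (EuclideanSpace.single i 1) q
        * F.energyDir e (EuclideanSpace.single j 1) q) (x, y) * (u i * v j) := by
    intro y
    simp only [weighted]
    rw [energyDir_eq_sum u, energyDir_eq_sum v, Finset.sum_mul_sum, Finset.mul_sum]
    refine Finset.sum_congr rfl fun i _ => ?_
    rw [Finset.mul_sum]
    refine Finset.sum_congr rfl fun j _ => ?_
    simp only [energyDir, energyDY, dY]
    ring
  have hint : ∀ i j, Integrable fun y : Coord n => F.weighted e (fun q => F.energyDir e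
      (EuclideanSpace.single i 1) q * F.energyDir e (EuclideanSpace.single j 1) q) (x, y)
        * (u i * v j) := fun i j =>
    (integrable_weighted he (contDiffOn_energyDir_mul he _ _) hx).mul_const _
  simp only [meanForm, h1]
  rw [integral_finsetSum _ fun i _ => integrable_finsetSum _ fun j _ => hint i j, Finset.mul_sum]
  refine Finset.sum_congr rfl fun i _ => ?_
  rw [integral_finsetSum _ fun j _ => hint i j, Finset.mul_sum]
  refine Finset.sum_congr rfl fun j _ => ?_
  rw [integral_mul_const, mul_assoc]

omit he in
theorem meanForm_symm (e : OpenPartialHomeomorph M (Coord n)) (x u v : Coord n) :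
    F.meanForm e x u v = F.meanForm e x v u := by
  simp only [meanForm, mul_comm (F.energyDir e u _)]

/-- A point of level two of `F²` on the ray through `v`. -/
theorem exists_energy_eq_two (hx : x ∈ e.target) {v : Coord n} (hv : v ≠ 0) :
    ∃ c : ℝ, 0 < c ∧ F.energy e (x, c • v) = 2 := by
  have hE : 0 < F.energy e (x, v) := energy_pos he ⟨hx, hv⟩
  refine ⟨√(2 / F.energy e (x, v)), Real.sqrt_pos.2 (by positivity), ?_⟩
  rw [F.energy_smul e x v (Real.sqrt_pos.2 (by positivity)), Real.sq_sqrt (by positivity)]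
  field_simp

/-- Level two is where the cut-off equals `1`, so the continuous non-negative integrand is non-zero
at that point. -/
theorem integral_weighted_pos {f : Coord n × Coord n → ℝ} (hf : ContDiffOn ℝ ∞ f (slit e))
    (hx : x ∈ e.target) (hpos : ∀ y, 0 ≤ f (x, y)) (hy : F.energy e (x, y) = 2)
    (hfy : f (x, y) ≠ 0) : 0 < ∫ y, F.weighted e f (x, y) := by
  refine (continuous_weighted he hf hx).integral_pos_of_hasCompactSupport_nonneg_nonzero
    (hasCompactSupport_weighted he f hx) (fun y => mul_nonneg cutoff.nonneg (hpos y)) (x := y) ?_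
  simp only [weighted, hy, cutoff_two, one_mul]
  exact hfy

theorem integral_weighted_one_pos (hx : x ∈ e.target) {v : Coord n} (hv : v ≠ 0) :
    0 < ∫ y, F.weighted e (fun _ => 1) (x, y) := by
  obtain ⟨c, -, hc⟩ := exists_energy_eq_two (F := F) he hx hv
  exact integral_weighted_pos he contDiffOn_const hx (fun _ => zero_le_one) hc one_ne_zero

/-- At the point `c • v` of level two, Euler's relation shows that the fibre derivative of `F²`
along `v` is non-zero. -/
theorem meanForm_pos (hx : x ∈ e.target) {v : Coord n} (hv : v ≠ 0) :
    0 < F.meanForm e x v v := by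
  refine mul_pos (inv_pos.2 (integral_weighted_one_pos he hx hv)) ?_
  obtain ⟨c, hc, hE⟩ := exists_energy_eq_two (F := F) he hx hv
  refine integral_weighted_pos he (contDiffOn_energyDir_mul he _ _) hx
    (fun y => mul_self_nonneg _) hE (mul_self_ne_zero.2 fun h0 => ?_)
  have hq : (x, c • v) ∈ slit e := ⟨hx, smul_ne_zero hc.ne' hv⟩
  have h1 := sum_coord_mul_energyDY (F := F) he hq
  rw [energyDir_eq_sum] at h0
  have h2 : ∑ k, (c • v) k * F.energyDY e k (x, c • v) = c * ∑ k, v k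
      * F.energyDY e k (x, c • v) := by
    rw [Finset.mul_sum]
    exact Finset.sum_congr rfl fun k _ => by simp [mul_assoc]
  simp only [h2, h0, hE] at h1
  norm_num at h1

theorem contDiffOn_meanForm (u v : Coord n) :
    ContDiffOn ℝ ∞ (fun x => F.meanForm e x u v) e.target := by
  -- A non-zero vector is needed for the normalizing integral to be known positive; for `u = 0` the
  -- form vanishes identically.
  rcases eq_or_ne u 0 with rfl | hu
  · refine contDiffOn_const (c := (0 : ℝ)) |>.congr fun x hx => ?_
    rw [meanForm_eq_sum he hx]
    simp
  · exact ((contDiffOn_integral_weighted he contDiffOn_const).inv fun x hx =>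
      (integral_weighted_one_pos he hx hu).ne').mul
        (contDiffOn_integral_weighted he (contDiffOn_energyDir_mul he u v))

/-- The mean form is parallel for a connection whose non-linear connection is that of `F`. -/
theorem pd_meanForm (hx : x ∈ e.target) {Γ : Fin n → Fin n → Fin n → ℝ}
    (hN : ∀ y, y ≠ 0 → ∀ i j, F.nonlin e x y i j = ∑ k, y k * Γ i j k) (i j k : Fin n) :
    pd k (fun x => F.meanForm e x (EuclideanSpace.single i 1) (EuclideanSpace.single j 1)) x
      = ∑ m, (F.meanForm e x (EuclideanSpace.single m 1) (EuclideanSpace.single j 1) * Γ m k i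
        + F.meanForm e x (EuclideanSpace.single i 1) (EuclideanSpace.single m 1) * Γ m k j) := by
  set V : Coord n → ℝ := fun x => ∫ y, F.weighted e (fun _ => 1) (x, y) with hV
  set I : Fin n → Fin n → Coord n → ℝ := fun i j x => ∫ y, F.weighted e
    (fun q => F.energyDY e i q * F.energyDY e j q) (x, y) with hI
  have hsm : ∀ i j, ContDiffOn ℝ ∞ (fun q => F.energyDY e i q * F.energyDY e j q) (slit e) :=
    fun i j => (contDiffOn_energyDY he i).mul (contDiffOn_energyDY he j)
  have hVx : V x ≠ 0 := (integral_weighted_one_pos he hx (v := EuclideanSpace.single i (1 : ℝ))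
    (by simp)).ne'
  have hmean : ∀ i j x, F.meanForm e x (EuclideanSpace.single i 1) (EuclideanSpace.single j 1)
      = (V x)⁻¹ * I i j x := fun i j x => rfl
  have hn := e.open_target.mem_nhds hx
  have hVd : DifferentiableAt ℝ V x :=
    ((contDiffOn_integral_weighted he contDiffOn_const).contDiffAt hn).differentiableAt (by simp)
  have hId : DifferentiableAt ℝ (I i j) x :=
    ((contDiffOn_integral_weighted he (hsm i j)).contDiffAt hn).differentiableAt (by simp)
  have hVk : pd k V x = -((∑ m, Γ m k m) * V x) := by
    have := pd_integral_weighted_of_transport (F := F) he (f := fun _ => 1) (r := fun _ => 0)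
      contDiffOn_const contDiffOn_const hx hN k (fun y _ => by simp [dX, dY, dirDeriv])
    simpa [weighted, hV] using this
  -- The part of the horizontal derivative left after transport: by `dX_energyDY_eq`, the remaining
  -- terms are fibre derivatives of the product.
  let r : Coord n × Coord n → ℝ := fun q => ∑ m, (Γ m k i * (F.energyDY e m q * F.energyDY e j q)
    + Γ m k j * (F.energyDY e i q * F.energyDY e m q))
  have hr : ContDiffOn ℝ ∞ r (slit e) := ContDiffOn.sum fun m _ =>
    (contDiffOn_const.mul (hsm m j)).add (contDiffOn_const.mul (hsm i m))
  have hIk : pd k (I i j) x = -((∑ m, Γ m k m) * I i j x)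
      + ∑ m, (Γ m k i * I m j x + Γ m k j * I i m x) := by
    have h1 := pd_integral_weighted_of_transport (F := F) he (hsm i j) hr hx hN k ?_
    · refine h1.trans ?_
      congr 1
      have h2 : ∀ y, F.weighted e r (x, y) = ∑ m, (Γ m k i * F.weighted e
          (fun q => F.energyDY e m q * F.energyDY e j q) (x, y) + Γ m k j * F.weighted e
          (fun q => F.energyDY e i q * F.energyDY e m q) (x, y)) := by
        intro y
        simp only [weighted, r, Finset.mul_sum]
        exact Finset.sum_congr rfl fun m _ => by ring
      have hint := fun i j => integrable_weighted (F := F) he (hsm i j) hx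
      simp only [h2]
      have hint' : ∀ m, Integrable fun y : Coord n => Γ m k i * F.weighted e
          (fun q => F.energyDY e m q * F.energyDY e j q) (x, y) + Γ m k j * F.weighted e
          (fun q => F.energyDY e i q * F.energyDY e m q) (x, y) := fun m =>
        ((hint m j).const_mul _).add ((hint i m).const_mul _)
      rw [integral_finsetSum _ fun m _ => hint' m]
      refine Finset.sum_congr rfl fun m _ => ?_
      rw [integral_add ((hint m j).const_mul _) ((hint i m).const_mul _), integral_const_mul,
        integral_const_mul]
    · intro y hy
      have hq : (x, y) ∈ slit e := ⟨hx, hy⟩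
      have hEd := fun i => differentiableAt_of_slit (contDiffOn_energyDY (F := F) he i) hq
      have hprod : ∀ w : Coord n × Coord n, dirDeriv w
          (fun q => F.energyDY e i q * F.energyDY e j q) (x, y)
          = dirDeriv w (F.energyDY e i) (x, y) * F.energyDY e j (x, y)
            + F.energyDY e i (x, y) * dirDeriv w (F.energyDY e j) (x, y) := by
        intro w
        simpa using dirDeriv_sum_mul (ι := Unit) (w := w) (a := fun _ => F.energyDY e i)
          (b := fun _ => F.energyDY e j) (fun _ => hEd i) (fun _ => hEd j)
      have hcomm : ∀ i m, dY i (F.energyDY e m) (x, y) = dY m (F.energyDY e i) (x, y) :=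
        fun i m => dirDeriv_comm (F.contDiffOn_energy he) (isOpen_slit e) hq
      have hX : ∀ i, dirDeriv (EuclideanSpace.single k 1, 0) (F.energyDY e i) (x, y) = _ :=
        fun i => dX_energyDY_eq (F := F) he hx hN hy k i
      simp only [dX, dY, hprod, hX, r]
      rw [Finset.sum_mul, Finset.mul_sum, ← Finset.sum_add_distrib, ← Finset.sum_add_distrib]
      refine Finset.sum_congr rfl fun m _ => ?_
      have hi := hcomm i m
      have hj := hcomm j m
      simp only [dY] at hi hj
      rw [hi, hj]
      ring
  -- The derivative of the quotient is read off from that of the product `V · mean = I`; the trace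
  -- terms of `hVk` and `hIk` cancel.
  have hprod : I i j =ᶠ[𝓝 x] fun x => V x * F.meanForm e x (EuclideanSpace.single i 1)
      (EuclideanSpace.single j 1) := by
    filter_upwards [hn] with z hz
    have hVz : V z ≠ 0 := (integral_weighted_one_pos he hz
      (v := EuclideanSpace.single i (1 : ℝ)) (by simp)).ne'
    rw [hmean, mul_inv_cancel_left₀ hVz]
  have hmd : DifferentiableAt ℝ (fun x => F.meanForm e x (EuclideanSpace.single i 1)
      (EuclideanSpace.single j 1)) x :=
    ((contDiffOn_meanForm he _ _).contDiffAt hn).differentiableAt (by simp)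
  have h1 : pd k (I i j) x = V x * pd k (fun x => F.meanForm e x (EuclideanSpace.single i 1)
      (EuclideanSpace.single j 1)) x + F.meanForm e x (EuclideanSpace.single i 1)
      (EuclideanSpace.single j 1) * pd k V x := by
    simp only [pd]
    rw [hprod.fderiv_eq, fderiv_fun_mul hVd hmd]
    simp
  have h2 : ∀ i j, I i j x = V x * F.meanForm e x (EuclideanSpace.single i 1)
      (EuclideanSpace.single j 1) := fun i j => by rw [hmean, mul_inv_cancel_left₀ hVx]
  rw [hIk, hVk] at h1
  simp only [h2] at h1
  refine mul_left_cancel₀ hVx ?_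
  have h3 : ∀ m, Γ m k i * (V x * F.meanForm e x (EuclideanSpace.single m 1)
      (EuclideanSpace.single j 1)) + Γ m k j * (V x * F.meanForm e x (EuclideanSpace.single i 1)
      (EuclideanSpace.single m 1)) = V x * (F.meanForm e x (EuclideanSpace.single m 1)
      (EuclideanSpace.single j 1) * Γ m k i + F.meanForm e x (EuclideanSpace.single i 1)
      (EuclideanSpace.single m 1) * Γ m k j) := fun m => by ring
  simp only [h3, ← Finset.mul_sum] at h1
  linarith

end MeanForm

end FinslerStructure
end Finsler

/-! ### The global averaged metric; Berwald implies affine equivalence. -/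

namespace Finsler

namespace FinslerStructure

open MeasureTheory

variable {n : ℕ} {M : Type*} [TopologicalSpace M] [ChartedSpace (Coord n) M]
  [IsManifold (𝓡 n) ∞ M] {F : FinslerStructure n M}
  {e e' : OpenPartialHomeomorph M (Coord n)} {x y : Coord n}

section Transition

variable (he : e ∈ IsManifold.maximalAtlas (𝓡 n) ∞ M)
  (he' : e' ∈ IsManifold.maximalAtlas (𝓡 n) ∞ M)
include he he'

theorem energy_transition (hx : x ∈ e.target) (hx' : e.symm x ∈ e'.source) (y : Coord n) :
    F.energy e' (transition e e' x, fderiv ℝ (transition e e') x y) = F.energy e (x, y) := by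
  simp only [energy, localRep, natPoint_transition he he' hx hx' y]

theorem energyDir_transition (hx : x ∈ e.target) (hx' : e.symm x ∈ e'.source) (hy : y ≠ 0)
    (u : Coord n) : F.energyDir e' (fderiv ℝ (transition e e') x u)
      (transition e e' x, fderiv ℝ (transition e e') x y) = F.energyDir e u (x, y) := by
  have h1 : DifferentiableAt ℝ (F.energy e) (x, y) :=
    differentiableAt_of_slit (F.contDiffOn_energy he) ⟨hx, hy⟩
  have h2 : DifferentiableAt ℝ (F.energy e')
      (transition e e' x, fderiv ℝ (transition e e') x y) :=
    differentiableAt_of_slit (F.contDiffOn_energy he')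
      ⟨e'.map_source hx', fderiv_transition_ne_zero he he' hx hx' hy⟩
  have h3 := h1.hasFDerivAt.comp y (hasFDerivAt_prodMk_right x y)
  have h4 := (h2.hasFDerivAt.comp _ (hasFDerivAt_prodMk_right (𝕜 := ℝ) (transition e e' x)
    (fderiv ℝ (transition e e') x y))).comp y (fderiv ℝ (transition e e') x).hasFDerivAt
  have h5 : (F.energy e ∘ fun y => (x, y)) = (F.energy e' ∘ fun y => (transition e e' x, y)) ∘
      fderiv ℝ (transition e e') x := funext fun y => (energy_transition he he' hx hx' y).symm
  rw [h5] at h3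
  have h6 := congrArg (fun T : Coord n →L[ℝ] ℝ => T u) (h4.unique h3)
  simpa [energyDir, dirDeriv] using h6

theorem integral_transition (hx : x ∈ e.target) (hx' : e.symm x ∈ e'.source)
    (k : Coord n → ℝ) : ∫ z, k z = |(fderiv ℝ (transition e e') x).det| *
      ∫ y, k (fderiv ℝ (transition e e') x y) := by
  have hinj : Function.Injective (fderiv ℝ (transition e e') x) := fun a b hab =>
    frame_injective he hx (by
      rw [← frame_transition he he' hx hx', ← frame_transition he he' hx hx', hab])
  have h1 := integral_image_eq_integral_abs_det_fderiv_smul (volume : Measure (Coord n))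
    MeasurableSet.univ (f := fderiv ℝ (transition e e') x)
    (fun y _ => (fderiv ℝ (transition e e') x).hasFDerivAt.hasFDerivWithinAt) hinj.injOn k
  rw [image_univ, (fderiv_transition_surjective he he' hx hx').range_eq] at h1
  simpa [integral_const_mul] using h1

theorem det_transition_ne_zero (hx : x ∈ e.target) (hx' : e.symm x ∈ e'.source) :
    (fderiv ℝ (transition e e') x).det ≠ 0 := by
  intro h0
  have hs := LinearMap.range_eq_top.2 (show Function.Surjective
    (fderiv ℝ (transition e e') x).toLinearMap from fderiv_transition_surjective he he' hx hx')
  exact absurd hs (LinearMap.range_lt_top_of_det_eq_zero h0).ne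

/-- Coordinate changes act linearly on fibres, so numerator and denominator both acquire the same
constant Jacobian, which cancels. -/
theorem meanForm_transition (hx : x ∈ e.target) (hx' : e.symm x ∈ e'.source) (u v : Coord n) :
    F.meanForm e' (transition e e' x) (fderiv ℝ (transition e e') x u)
      (fderiv ℝ (transition e e') x v) = F.meanForm e x u v := by
  have hdet : |(fderiv ℝ (transition e e') x).det| ≠ 0 :=
    abs_ne_zero.2 (det_transition_ne_zero he he' hx hx')
  have h1 : ∀ y, F.weighted e' (fun q => F.energyDir e' (fderiv ℝ (transition e e') x u) q
      * F.energyDir e' (fderiv ℝ (transition e e') x v) q)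
        (transition e e' x, fderiv ℝ (transition e e') x y)
      = F.weighted e (fun q => F.energyDir e u q * F.energyDir e v q) (x, y) := by
    intro y
    rcases eq_or_ne y 0 with rfl | hy
    · rw [map_zero, weighted_zero he _ hx, weighted_zero he' _
        (show transition e e' x ∈ e'.target from e'.map_source hx')]
    · simp only [weighted, energy_transition he he' hx hx', energyDir_transition he he' hx hx' hy]
  have h2 : ∀ y, F.weighted e' (fun _ => 1) (transition e e' x, fderiv ℝ (transition e e') x y)
      = F.weighted e (fun _ => 1) (x, y) := fun y => by
    simp only [weighted, energy_transition he he' hx hx']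
  simp only [meanForm]
  rw [integral_transition he he' hx hx' fun z => F.weighted e' (fun _ => 1)
      (transition e e' x, z),
    integral_transition he he' hx hx' fun z => F.weighted e' (fun q => F.energyDir e'
      (fderiv ℝ (transition e e') x u) q * F.energyDir e' (fderiv ℝ (transition e e') x v) q)
      (transition e e' x, z)]
  simp only [h1, h2, mul_inv]
  field_simp

end Transition

variable (F) in
/-- The field of mean forms, as bilinear forms on the tangent spaces. -/
def meanField (p : M) : TangentSpace (𝓡 n) p →L[ℝ] TangentSpace (𝓡 n) p →L[ℝ] ℝ :=
  (∑ i, ∑ j, F.meanForm (chartAt (Coord n) p) (chartAt (Coord n) p p)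
    (EuclideanSpace.single i 1) (EuclideanSpace.single j 1) •
      (EuclideanSpace.proj (𝕜 := ℝ) i : Coord n →L[ℝ] ℝ).smulRight
        (EuclideanSpace.proj (𝕜 := ℝ) j : Coord n →L[ℝ] ℝ) : Coord n →L[ℝ] Coord n →L[ℝ] ℝ)

theorem meanField_apply (p : M) (u v : Coord n) : F.meanField p u v
    = F.meanForm (chartAt (Coord n) p) (chartAt (Coord n) p p) u v := by
  rw [meanForm_eq_sum (IsManifold.chart_mem_maximalAtlas p)
    ((chartAt (Coord n) p).map_source (mem_chart_source _ p))]
  have : F.meanField p u v = (∑ i, ∑ j, F.meanForm (chartAt (Coord n) p) (chartAt (Coord n) p p)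
    (EuclideanSpace.single i 1) (EuclideanSpace.single j 1) •
      (EuclideanSpace.proj (𝕜 := ℝ) i : Coord n →L[ℝ] ℝ).smulRight
        (EuclideanSpace.proj (𝕜 := ℝ) j : Coord n →L[ℝ] ℝ) : Coord n →L[ℝ] Coord n →L[ℝ] ℝ) u v :=
    rfl
  rw [this]
  simp [sum_apply]

/-- The preferred chart at `p` has identity frame, so the derivative of the change from `e` to it is
the frame of `e`. Invariance of the mean form then gives the claim. -/
theorem pullForm_meanField (he : e ∈ IsManifold.maximalAtlas (𝓡 n) ∞ M) (hx : x ∈ e.target)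
    (u v : Coord n) : pullForm F.meanField e x u v = F.meanForm e x u v := by
  set p := e.symm x with hp
  have he' : chartAt (Coord n) p ∈ IsManifold.maximalAtlas (𝓡 n) ∞ M :=
    IsManifold.chart_mem_maximalAtlas p
  have hx' : e.symm x ∈ (chartAt (Coord n) p).source := mem_chart_source _ p
  have h1 : ∀ w, fderiv ℝ (transition e (chartAt (Coord n) p)) x w = frame e x w := by
    intro w
    rw [← frame_transition he he' hx hx' w]
    exact (frame_chartAt_self p _).symm
  rw [← meanForm_transition he he' hx hx', h1, h1]
  exact meanField_apply p _ _

theorem meanField_pos (p : M) {v : Coord n} (hv : v ≠ 0) : 0 < F.meanField p v v := by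
  rw [meanField_apply]
  exact meanForm_pos (IsManifold.chart_mem_maximalAtlas p)
    ((chartAt (Coord n) p).map_source (mem_chart_source _ p)) hv

/-- By compactness `1 / B v v` is bounded on the unit sphere, and scaling bounds `‖v‖²` by a
multiple of `B v v`. This is a field of `ContMDiffRiemannianMetric`. -/
theorem isVonNBounded_of_pos (B : Coord n →L[ℝ] Coord n →L[ℝ] ℝ)
    (hB : ∀ v, v ≠ 0 → 0 < B v v) : Bornology.IsVonNBounded ℝ {v : Coord n | B v v < 1} := by
  rw [NormedSpace.isVonNBounded_iff, isBounded_iff_forall_norm_le]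
  have hc : Continuous fun v => B v v := by fun_prop
  obtain ⟨C, hC⟩ := (isCompact_sphere (0 : Coord n) 1).bddAbove_image
    ((hc.continuousOn (s := Metric.sphere (0 : Coord n) 1)).inv₀ fun v hv =>
      (hB v (Metric.ne_of_mem_sphere hv one_ne_zero)).ne')
  refine ⟨max 1 C, fun v hv => ?_⟩
  rcases eq_or_ne v 0 with rfl | hv0
  · simp
  have hn : 0 < ‖v‖ := norm_pos_iff.2 hv0
  have h1 : ‖v‖⁻¹ • v ∈ Metric.sphere (0 : Coord n) 1 := by simp [norm_smul, hn.ne']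
  have h2 : (B (‖v‖⁻¹ • v) (‖v‖⁻¹ • v))⁻¹ ≤ C := hC (mem_image_of_mem _ h1)
  have h3 : B (‖v‖⁻¹ • v) (‖v‖⁻¹ • v) = (‖v‖⁻¹) ^ 2 * B v v := by
    simp only [map_smul, smul_apply, smul_eq_mul]
    ring
  have h4 := hB v hv0
  rw [h3, inv_le_iff_one_le_mul₀ (by positivity)] at h2
  have h5 : ‖v‖ ^ 2 ≤ C * B v v := by
    have := mul_le_mul_of_nonneg_left h2 (sq_nonneg ‖v‖)
    have h6 : ‖v‖ ^ 2 * (C * (‖v‖⁻¹ ^ 2 * B v v)) = C * B v v := by field_simp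
    linarith
  have h7 : B v v < 1 := hv
  by_contra hlt
  rw [not_le] at hlt
  have h8 : 1 < ‖v‖ := (le_max_left _ _).trans_lt hlt
  have h9 : C < ‖v‖ := (le_max_right _ _).trans_lt hlt
  nlinarith

variable (F) in
/-- The Riemannian metric obtained by averaging over the fibres. -/
def meanMetric : RiemMetric n M where
  inner := F.meanField
  symm p v w := by
    exact (meanField_apply p v w).trans ((meanForm_symm _ _ _ _).trans
      (meanField_apply p w v).symm)
  pos p v hv := meanField_pos p hv
  isVonNBounded p := isVonNBounded_of_pos (F.meanField p) fun v hv => meanField_pos p hv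
  contMDiff := contMDiff_section_of_pullForm _ fun e he i j =>
    (contDiffOn_meanForm he _ _).congr fun x hx => pullForm_meanField he hx _ _

theorem comp_meanMetric (he : e ∈ IsManifold.maximalAtlas (𝓡 n) ∞ M) (hx : x ∈ e.target)
    (i j : Fin n) : RiemMetric.comp F.meanMetric e x i j
      = F.meanForm e x (EuclideanSpace.single i 1) (EuclideanSpace.single j 1) :=
  pullForm_meanField he hx _ _

/-- For a Berwald structure the Levi-Civita connection of the mean metric is the linear Berwald
connection. -/
theorem leviCivitaCoeff_meanMetric (hF : F.IsBerwald)
    (he : e ∈ IsManifold.maximalAtlas (𝓡 n) ∞ M) (hx : x ∈ e.target) (hy : y ≠ 0) :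
    F.meanMetric.leviCivitaCoeff e x y = F.berwaldCoeff e x y := by
  have hΓ : ∀ y', y' ≠ 0 → F.chernCoeff e x y' = F.chernCoeff e x y := fun y' hy' =>
    hF e he x hx y' y hy' hy
  have hsymm := ((chernCoeff_unique (F := F) he hx hy _).2 rfl).1
  rw [berwaldCoeff_eq_of_chernCoeff_eq he hx hΓ hy]
  refine RiemMetric.leviCivitaCoeff_eq_of_metric _ he hx hsymm (fun i j k => ?_) y
  -- Parallelism of the mean form is metric compatibility, up to exchanging the lower indices of
  -- `Γ`.
  rw [pd_congr e.open_target (fun z hz => comp_meanMetric he hz i j) hx,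
    pd_meanForm he hx (fun y' hy' => nonlin_eq_of_chernCoeff_eq he hx hΓ hy') i j k]
  refine Finset.sum_congr rfl fun m _ => ?_
  rw [comp_meanMetric he hx, comp_meanMetric he hx, hsymm m k i, hsymm m k j]

/-- The two families of coefficients agree for `y ≠ 0`, and the geodesic equation uses them only at
non-zero velocities. -/
theorem affinelyEquivalent_meanMetric (hF : F.IsBerwald) :
    AffinelyEquivalent F.meanMetric F := by
  intro J _ _ c
  refine and_congr_right fun _ => forall₂_congr fun e he => forall₃_congr fun t _ ht =>
    and_congr_right fun hne => forall_congr' fun i => ?_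
  rw [leviCivitaCoeff_meanMetric hF he (e.map_source ht) hne]

end FinslerStructure
end Finsler

end

theorem proposition3p5 {n : ℕ} {M : Type*} [TopologicalSpace M]
    [ChartedSpace (EuclideanSpace ℝ (Fin n)) M]
    [IsManifold (modelWithCornersSelf ℝ (EuclideanSpace ℝ (Fin n))) ∞ M]
    (F : Finsler.FinslerStructure n M) :
    (∃ h : Finsler.RiemMetric n M, Finsler.AffinelyEquivalent h F) ↔ F.IsBerwald :=
  ⟨fun ⟨h, hF⟩ => h.isBerwald_of_affinelyEquivalent hF,
    fun hF => ⟨F.meanMetric, Finsler.FinslerStructure.affinelyEquivalent_meanMetric hF⟩⟩
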